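/- Let $(M,g)$ be a smooth Riemannian surface (a 2-dimensional smooth manifold with a smooth Riemannian metric) with Gaussian curvature $c:M\to\mathbb R$. Let a semicolon denote Levi-Civita covariant differentiation, and let $R_{abc}{}^{d}$ be the curvature tensor, normalised by $\nabla_a\nabla_bA_c-\nabla_b\nabla_aA_c=R_{abc}{}^{d}A_d$ for one-forms $A$. On the bundle $W=T^*M\oplus\Lambda^2T^*M$, whose elements are written $K+L$ with $K=(K_a)$ and $L=(L_{ab})$ skew-symmetric, consider the connection $$\nabla_i(K+L)=(K_{a;i}-L_{ai})+(L_{ab;i}-R_{abi}{}^{c}K_c),$$ with curvature $F(\partial_i,\partial_j)=\nabla_i\nabla_j-\nabla_j\nabla_i$. Define subsets of $W$ by $$V^{(0)}=\{w\in W: F(\cdot,\cdot)w=0\},\qquad W^{(n)}=\mathcal S(V^{(n)}),\qquad V^{(n+1)}=\ker\alpha_{W^{(n)}}\qquad(n\ge 0).$$ Here $\mathcal S(V)$ is the set of those $v\in V$ through which there passes a smooth local section of $W$ with values in $V$, and $\ker\alpha_{W'}$ is the set of values $X(x)$ of smooth local sections $X$ of $W$ with values in $W'$ that satisfy $\nabla_iX(x)\in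 W'_x$ for all $i$. The surface is called regular if for every $n\ge 0$ one has $W^{(n)}=V^{(n)}$ and $\dim V^{(n)}_x$ is independent of $x\in M$. Suppose that $(M,g)$ is regular, that $c$ is not constant, and that $M$ possesses a Killing field, i.e. a smooth vector field $X$ on $M$, not identically zero, with $K_{a;b}+K_{b;a}=0$ for $K_a=g_{ab}X^b$. Then every integral curve $\gamma:J\to M$ ($J\subseteq\mathbb R$ an open interval) of the gradient field $\partial c=\operatorname{grad}c$ is a geodesic path: there are a smooth function $\varphi:J\to\mathbb R$ with $\varphi'>0$ and a geodesic $\sigma:\varphi(J)\to M$ such that $\gamma=\sigma\circ\varphi$. -/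

import Mathlib

open scoped Manifold ContDiff Topology Bundle

noncomputable section

/-- The coordinate plane. -/
abbrev Plane : Type := EuclideanSpace ℝ (Fin 2)

/-! ### Tensor calculus of a metric in local coordinates

Here `G u` is the matrix `(g_{ij})` of a Riemannian metric at the point with coordinates `u`. All
of the expressions below depend only on the germ of `G` at `u`. -/

namespace LocalSurface

/-- The partial derivative `∂_i f` at `u`. -/
def pd (i : Fin 2) (f : Plane → ℝ) (u : Plane) : ℝ :=
  fderiv ℝ f u (EuclideanSpace.single i 1)

/-- The Christoffel symbol `Γ^k_{ij}` of the Levi-Civita connection. -/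
def christoffel (G : Plane → Matrix (Fin 2) (Fin 2) ℝ) (k i j : Fin 2) (u : Plane) : ℝ :=
  (1 / 2 : ℝ) * ∑ l, (G u)⁻¹ k l *
    (pd i (fun v => G v j l) u + pd j (fun v => G v i l) u - pd l (fun v => G v i j) u)

/-- The component `R_{abc}^d` of the Riemann curvature tensor, with the convention
`∇_a ∇_b A_c - ∇_b ∇_a A_c = R_{abc}^d A_d` for one-forms `A`. -/
def riemann (G : Plane → Matrix (Fin 2) (Fin 2) ℝ) (a b c d : Fin 2) (u : Plane) : ℝ :=
  pd b (christoffel G d a c) u - pd a (christoffel G d b c) u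
    + ∑ e, (christoffel G e a c u * christoffel G d e b u
        - christoffel G e b c u * christoffel G d e a u)

/-- The Gaussian curvature `R_{0101} / det g`, with `R_{abcd} = R_{abc}^e g_{ed}`
(it is positive for round spheres). -/
def gauss (G : Plane → Matrix (Fin 2) (Fin 2) ℝ) (u : Plane) : ℝ :=
  (∑ d, riemann G 0 1 0 d u * G u d 1) / (G u).det

/-- The covariant derivative `K_{a;b}` of a one-form `K = K_a dx^a`. -/
def covDeriv (G : Plane → Matrix (Fin 2) (Fin 2) ℝ) (K : Plane → Fin 2 → ℝ) (a b : Fin 2)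
    (u : Plane) : ℝ :=
  pd b (fun v => K v a) u - ∑ c, christoffel G c a b u * K u c

/-- The covariant derivative `L_{ab;i}` of a covariant two-tensor `L`. -/
def covDeriv₂ (G : Plane → Matrix (Fin 2) (Fin 2) ℝ) (L : Plane → Fin 2 → Fin 2 → ℝ)
    (a b i : Fin 2) (u : Plane) : ℝ :=
  pd i (fun v => L v a b) u
    - ∑ c, (christoffel G c a i u * L u c b + christoffel G c b i u * L u a c)

/-- Components of elements of `T* ⊕ (T* ⊗ T*)`. An element `K + L` of the fibre of
`W = T* ⊕ Λ² T*` is a pair `(K, L)` such that `L` is skew-symmetric. -/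
abbrev Comp : Type := (Fin 2 → ℝ) × (Fin 2 → Fin 2 → ℝ)

/-- The connection on `W`:
`∇_i (K + L) = (K_{a;i} - L_{ai}) + (L_{ab;i} - R_{abi}^c K_c)`. -/
def nabla (G : Plane → Matrix (Fin 2) (Fin 2) ℝ) (i : Fin 2) (X : Plane → Comp) (u : Plane) :
    Comp :=
  (fun a => covDeriv G (fun v => (X v).1) a i u - (X u).2 a i,
   fun a b => covDeriv₂ G (fun v => (X v).2) a b i u - ∑ c, riemann G a b i c u * (X u).1 c)

/-- The curvature `F(∂_i, ∂_j)(w) = ∇_i ∇_j w - ∇_j ∇_i w` of `∇` at `u`. As `F` is tensorial, it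
may be computed by extending `w` with constant components. -/
def curvW (G : Plane → Matrix (Fin 2) (Fin 2) ℝ) (i j : Fin 2) (u : Plane) (w : Comp) : Comp :=
  nabla G i (nabla G j (fun _ => w)) u - nabla G j (nabla G i (fun _ => w)) u

/-- `s` is a smooth section, over an open neighbourhood of `u`, of the family of subsets `V`. -/
def IsLocalSection (V : Plane → Set Comp) (u : Plane) (s : Plane → Comp) : Prop :=
  ∃ N : Set Plane, IsOpen N ∧ u ∈ N ∧ ContDiffOn ℝ ∞ s N ∧ ∀ v ∈ N, s v ∈ V v

/-- The leveling `𝒮(V)`: the elements of `V` through which a smooth local section of `V` passes. -/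
def level (V : Plane → Set Comp) (u : Plane) : Set Comp :=
  {w | ∃ s, IsLocalSection V u s ∧ s u = w}

/-- The kernel of `α : W' → (W / W') ⊗ T*`, `X ↦ ∇ X mod W'`. Where `W'` is a vector bundle,
the class `∇ X mod W'` at `u` depends only on the value at `u` of the section `X` of `W'`. -/
def kerAlpha (G : Plane → Matrix (Fin 2) (Fin 2) ℝ) (W' : Plane → Set Comp) (u : Plane) :
    Set Comp :=
  {w | ∃ s, IsLocalSection W' u s ∧ s u = w ∧ ∀ i, nabla G i s u ∈ W' u}

/-- The sets `V^(n)` of the derived flag: `V^(0) = ker F` and `V^(n+1) = ker α_{W^(n)}`, where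
`W^(n) = 𝒮(V^(n))`. -/
def flagV (G : Plane → Matrix (Fin 2) (Fin 2) ℝ) : ℕ → Plane → Set Comp
  | 0 => fun u => {w | (∀ a b, w.2 a b = -w.2 b a) ∧ ∀ i j, curvW G i j u w = 0}
  | n + 1 => kerAlpha G (level (flagV G n))

/-- The sets `W^(n) = 𝒮(V^(n))` of the derived flag. -/
def flagW (G : Plane → Matrix (Fin 2) (Fin 2) ℝ) (n : ℕ) : Plane → Set Comp :=
  level (flagV G n)

end LocalSurface

/-! ### Riemannian surfaces -/

/-- A positive definite bilinear form on a finite-dimensional space identifies it with its dual. -/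
theorem bijective_of_pos {E : Type*} [NormedAddCommGroup E] [NormedSpace ℝ E]
    [FiniteDimensional ℝ E] (B : E →L[ℝ] E →L[ℝ] ℝ) (hB : ∀ v, v ≠ 0 → 0 < B v v) :
    Function.Bijective B := by
  have hinj : Function.Injective B.toLinearMap := by
    rw [injective_iff_map_eq_zero]
    intro v hv
    by_contra hne
    have h1 : B v = 0 := hv
    have h2 := hB v hne
    simp [h1] at h2
  have hdim : Module.finrank ℝ E = Module.finrank ℝ (E →L[ℝ] ℝ) := by
    rw [← (LinearMap.toContinuousLinearMap (𝕜 := ℝ) (E := E) (F' := ℝ)).finrank_eq]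
    exact (Subspace.dual_finrank_eq (K := ℝ) (V := E)).symm
  exact ⟨hinj, (LinearMap.injective_iff_surjective_of_finrank_eq_finrank hdim).1 hinj⟩

/-- A smooth Riemannian metric on a surface. -/
abbrev SurfaceMetric (M : Type*) [TopologicalSpace M] [ChartedSpace Plane M]
    [IsManifold (𝓡 2) ∞ M] : Type _ :=
  Bundle.ContMDiffRiemannianMetric (𝓡 2) ∞ Plane (fun x : M => TangentSpace (𝓡 2) x)

namespace SurfaceMetric

open LocalSurface

variable {M : Type*} [TopologicalSpace M] [ChartedSpace Plane M] [IsManifold (𝓡 2) ∞ M]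

/-- The coordinate vector `∂_i` of the chart `e` at the point with coordinates `u`. -/
def coordVec (e : OpenPartialHomeomorph M Plane) (i : Fin 2) (u : Plane) :
    TangentSpace (𝓡 2) (e.symm u) :=
  mfderiv (𝓡 2) (𝓡 2) e.symm u (EuclideanSpace.single i (1 : ℝ) : Plane)

/-- The matrix `g_{ij} = g(∂_i, ∂_j)` of the metric in the chart `e`. -/
def inChart (g : SurfaceMetric M) (e : OpenPartialHomeomorph M Plane) (u : Plane) :
    Matrix (Fin 2) (Fin 2) ℝ :=
  Matrix.of fun i j => g.inner (e.symm u) (coordVec e i u) (coordVec e j u)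

/-- The Gaussian curvature `c : M → ℝ`, computed at `x` in the preferred chart at `x`. -/
def gaussianCurvature (g : SurfaceMetric M) (x : M) : ℝ :=
  gauss (g.inChart (chartAt Plane x)) (chartAt Plane x x)

/-- `g` is a nondegenerate form on each tangent space. -/
theorem inner_bijective (g : SurfaceMetric M) (x : M) :
    Function.Bijective (g.inner x) :=
  bijective_of_pos (E := Plane) (g.inner x) (g.pos x)

/-- The gradient of `f`: the vector field with `g(grad f, w) = df(w)` for all `w`. -/
def grad (g : SurfaceMetric M) (f : M → ℝ) (x : M) : TangentSpace (𝓡 2) x :=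
  (Equiv.ofBijective _ (g.inner_bijective x)).symm (mfderiv (𝓡 2) 𝓘(ℝ, ℝ) f x)

theorem inner_grad (g : SurfaceMetric M) (f : M → ℝ) (x : M) (w : TangentSpace (𝓡 2) x) :
    g.inner x (g.grad f x) w = mfderiv (𝓡 2) 𝓘(ℝ, ℝ) f x w :=
  congrArg (fun L : TangentSpace (𝓡 2) x →L[ℝ] ℝ => L w)
    ((Equiv.ofBijective _ (g.inner_bijective x)).apply_symm_apply (mfderiv (𝓡 2) 𝓘(ℝ, ℝ) f x))

/-- `X` is a Killing field: a smooth vector field with `K_{a;b} + K_{b;a} = 0` in all charts, where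
`K_a = g(X, ∂_a)`. -/
def IsKilling (g : SurfaceMetric M) (X : ∀ x : M, TangentSpace (𝓡 2) x) : Prop :=
  ContMDiff (𝓡 2) (𝓡 2).tangent ∞ (fun x => (⟨x, X x⟩ : TangentBundle (𝓡 2) M)) ∧
  ∀ e ∈ IsManifold.maximalAtlas (𝓡 2) ∞ M, ∀ u ∈ e.target, ∀ a b : Fin 2,
    covDeriv (g.inChart e) (fun v a => g.inner (e.symm v) (X (e.symm v)) (coordVec e a v)) a b u +
    covDeriv (g.inChart e) (fun v a => g.inner (e.symm v) (X (e.symm v)) (coordVec e a v)) b a u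
      = 0

/-- The surface is regular: for every `n`, `W^(n) = V^(n)` and this has constant rank on `M`. (The
fibres are linear subspaces, so that `Set.finrank`, the dimension of the span, is their
dimension.) -/
def IsRegular (g : SurfaceMetric M) : Prop :=
  ∀ n : ℕ, ∃ r : ℕ, ∀ e ∈ IsManifold.maximalAtlas (𝓡 2) ∞ M, ∀ u ∈ e.target,
    flagW (g.inChart e) n u = flagV (g.inChart e) n u ∧
    Set.finrank ℝ (flagV (g.inChart e) n u) = r

/-- The restriction of `σ` to the open set of times `J` is a geodesic: it is smooth and satisfies
`σ̈^k + Γ^k_{ij} σ̇^i σ̇^j = 0` in all charts. -/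
def IsGeodesicOn (g : SurfaceMetric M) (σ : ℝ → M) (J : Set ℝ) : Prop :=
  ContMDiffOn 𝓘(ℝ, ℝ) (𝓡 2) ∞ σ J ∧
  ∀ e ∈ IsManifold.maximalAtlas (𝓡 2) ∞ M, ∀ t ∈ J, σ t ∈ e.source → ∀ k : Fin 2,
    deriv (deriv fun τ => e (σ τ) k) t +
      ∑ i, ∑ j, christoffel (g.inChart e) k i j (e (σ t)) *
        deriv (fun τ => e (σ τ) i) t * deriv (fun τ => e (σ τ) j) t = 0

/-- The curve `γ` on the open interval `J` is a geodesic path: `γ = σ ∘ φ` for a smooth change of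
parameter `φ` with positive derivative and a geodesic `σ` on the interval `φ(J)`. -/
def IsGeodesicPathOn (g : SurfaceMetric M) (γ : ℝ → M) (J : Set ℝ) : Prop :=
  ∃ (φ : ℝ → ℝ) (σ : ℝ → M), ContDiffOn ℝ ∞ φ J ∧ (∀ t ∈ J, 0 < deriv φ t) ∧
    g.IsGeodesicOn σ (φ '' J) ∧ ∀ t ∈ J, γ t = σ (φ t)

end SurfaceMetric

end

noncomputable section

set_option linter.unusedSectionVars false

/-! Write `V = grad c`. In dimension two the curvature `F` of the connection on `W` has only a Λ²
component, and this is the area factor times `K(V)`; hence `V^(0)` is given by the single equation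
`K(V) = 0` (`mem_flagV_zero`). Its rank is 3 where `V` vanishes and 2 elsewhere, so constancy of the
rank makes `V` vanish everywhere or nowhere (`IsRegular.gradComp_eq_zero_or_ne_zero`). If it
vanishes everywhere, integral curves are stationary.

Otherwise, a Killing form `K` together with its covariant derivative is a parallel section of `W`,
so it lies in `V^(1)` (`killing_mem_flagV_one`). Thus `V^(1)` is nonzero at some point and, by
constancy of its rank, at every point. A nonzero `K + L` in `V^(1)` satisfies `K(V) = 0` and, after
differentiation, `K_a V^a_{;i} + L_{ai} V^a = 0`. Contraction with `V^i` removes the skew term, so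
`K` annihilates both `V` and `∇_V V`; moreover `K ≠ 0`. In dimension two this makes `∇_V V`
proportional to `V` (`selfDeriv_of_mem_flagV_one`).

Then the unit field `V/|V|` is autoparallel (`selfDeriv_normalize`), and an integral curve of `V`,
parametrised by arc length, is an integral curve of the unit field, hence a geodesic
(`isGeodesicPathOn_of_solvesOn`).

These computations are done in coordinates. The invariance of the Gaussian curvature under changes
of chart (`IsIsometryOn.gauss_eq`) carries them to `M`. -/

namespace LocalSurface

/-! ### Partial derivatives -/

section PartialDerivatives

variable {f g : Plane → ℝ} {u : Plane} {U : Set Plane} {i j : Fin 2}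

@[fun_prop]
theorem contDiffAt_pd (hf : ContDiffAt ℝ ∞ f u) : ContDiffAt ℝ ∞ (fun v => pd i f v) u := by
  unfold pd
  exact (hf.fderiv_right (m := ∞) (by simp)).clm_apply contDiffAt_const

theorem pd_congr (hU : IsOpen U) (hu : u ∈ U) (h : ∀ v ∈ U, f v = g v) : pd i f u = pd i g u := by
  unfold pd
  rw [Filter.EventuallyEq.fderiv_eq]
  filter_upwards [hU.mem_nhds hu] with v hv using h v hv

theorem pd_const (r : ℝ) : pd i (fun _ => r) u = 0 := by simp [pd]

theorem _root_.ContDiffAt.differentiableAt_infty (hf : ContDiffAt ℝ ∞ f u) :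
    DifferentiableAt ℝ f u := hf.differentiableAt (by simp)

theorem pd_add (hf : ContDiffAt ℝ ∞ f u) (hg : ContDiffAt ℝ ∞ g u) :
    pd i (fun v => f v + g v) u = pd i f u + pd i g u := by
  unfold pd
  rw [fderiv_fun_add hf.differentiableAt_infty hg.differentiableAt_infty]
  rfl

theorem pd_sub (hf : ContDiffAt ℝ ∞ f u) (hg : ContDiffAt ℝ ∞ g u) :
    pd i (fun v => f v - g v) u = pd i f u - pd i g u := by
  unfold pd
  rw [fderiv_fun_sub hf.differentiableAt_infty hg.differentiableAt_infty]
  rfl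

theorem pd_neg : pd i (fun v => -f v) u = -pd i f u := by
  unfold pd
  rw [fderiv_fun_neg]
  rfl

theorem pd_mul (hf : ContDiffAt ℝ ∞ f u) (hg : ContDiffAt ℝ ∞ g u) :
    pd i (fun v => f v * g v) u = pd i f u * g u + f u * pd i g u := by
  unfold pd
  rw [fderiv_fun_mul hf.differentiableAt_infty hg.differentiableAt_infty]
  simp [mul_comm, add_comm]

theorem pd_comm (hf : ContDiffAt ℝ ∞ f u) : pd i (pd j f) u = pd j (pd i f) u := by
  have key : ∀ i j, pd i (pd j f) u =
      fderiv ℝ (fderiv ℝ f) u (EuclideanSpace.single i 1) (EuclideanSpace.single j 1) := by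
    intro i j
    have h : DifferentiableAt ℝ (fderiv ℝ f) u :=
      (hf.fderiv_right (m := ∞) (by simp)).differentiableAt (by simp)
    change fderiv ℝ (fun v => fderiv ℝ f v (EuclideanSpace.single j 1)) u _ = _
    rw [fderiv_clm_apply h (differentiableAt_const _)]
    simp
  rw [key, key]
  have h2 : minSmoothness ℝ 2 ≤ ∞ := by
    simp only [minSmoothness_of_isRCLikeNormedField]
    exact WithTop.coe_le_coe.2 (le_top : (2 : ℕ∞) ≤ ⊤)
  exact (hf.isSymmSndFDerivAt h2).eq _ _

theorem plane_eq_sum (v : Plane) : v = ∑ k, v k • EuclideanSpace.single k (1 : ℝ) := by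
  ext k
  fin_cases k <;> simp

theorem fderiv_apply_eq_sum (f : Plane → ℝ) (u v : Plane) :
    fderiv ℝ f u v = ∑ k, v k * pd k f u := by
  conv_lhs => rw [plane_eq_sum v]
  simp [pd]

theorem pd_comp {φ : Plane → Plane} (hf : ContDiffAt ℝ ∞ f (φ u)) (hφ : ContDiffAt ℝ ∞ φ u) :
    pd i (fun v => f (φ v)) u =
      pd 0 f (φ u) * pd i (fun v => φ v 0) u + pd 1 f (φ u) * pd i (fun v => φ v 1) u := by
  have hφ' : DifferentiableAt ℝ φ u := hφ.differentiableAt (by simp)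
  have hk : ∀ k, pd i (fun v => φ v k) u = fderiv ℝ φ u (EuclideanSpace.single i 1) k := by
    intro k
    have := ((EuclideanSpace.proj k : Plane →L[ℝ] ℝ).hasFDerivAt.comp u hφ'.hasFDerivAt).fderiv
    unfold pd
    change fderiv ℝ ((EuclideanSpace.proj k : Plane →L[ℝ] ℝ) ∘ φ) u _ = _
    rw [this]
    rfl
  have h : pd i (fun v => f (φ v)) u
      = fderiv ℝ f (φ u) (fderiv ℝ φ u (EuclideanSpace.single i 1)) := by
    unfold pd
    change fderiv ℝ (f ∘ φ) u _ = _
    rw [fderiv_comp u hf.differentiableAt_infty hφ']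
    rfl
  rw [h, fderiv_apply_eq_sum, Fin.sum_univ_two, hk, hk]
  ring

end PartialDerivatives

/-! ### Levi-Civita connection of a metric on a plane domain. -/

/-- `G` is the coordinate expression of a smooth Riemannian metric on the open set `U`. -/
structure IsMetricOn (G : Plane → Matrix (Fin 2) (Fin 2) ℝ) (U : Set Plane) : Prop where
  isOpen : IsOpen U
  contDiffAt : ∀ u ∈ U, ∀ i j, ContDiffAt ℝ ∞ (fun v => G v i j) u
  symm : ∀ u ∈ U, ∀ i j, G u i j = G u j i
  pos : ∀ u ∈ U, 0 < G u 0 0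
  det_pos : ∀ u ∈ U, 0 < G u 0 0 * G u 1 1 - G u 0 1 * G u 0 1

namespace IsMetricOn

variable {G : Plane → Matrix (Fin 2) (Fin 2) ℝ} {U : Set Plane} {u : Plane}

theorem det_eq (hG : IsMetricOn G U) (hu : u ∈ U) :
    (G u).det = G u 0 0 * G u 1 1 - G u 0 1 * G u 0 1 := by
  rw [Matrix.det_fin_two, hG.symm u hu 1 0]

theorem det_ne_zero (hG : IsMetricOn G U) (hu : u ∈ U) : (G u).det ≠ 0 := by
  rw [hG.det_eq hu]
  exact (hG.det_pos u hu).ne'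

theorem contDiffAt_det (hG : IsMetricOn G U) (hu : u ∈ U) :
    ContDiffAt ℝ ∞ (fun v => (G v).det) u := by
  have := hG.contDiffAt u hu
  simp only [Matrix.det_fin_two]
  fun_prop

theorem contDiffAt_inv (hG : IsMetricOn G U) (hu : u ∈ U) (i j : Fin 2) :
    ContDiffAt ℝ ∞ (fun v => (G v)⁻¹ i j) u := by
  have h1 := (hG.contDiffAt_det hu).inv (hG.det_ne_zero hu)
  have h2 := hG.contDiffAt u hu
  simp only [Matrix.inv_def, Matrix.adjugate_fin_two, Ring.inverse_eq_inv', Matrix.smul_apply,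
    smul_eq_mul]
  refine h1.mul ?_
  fin_cases i <;> fin_cases j <;> simp <;> fun_prop

theorem contDiffAt_christoffel (hG : IsMetricOn G U) (hu : u ∈ U) (k i j : Fin 2) :
    ContDiffAt ℝ ∞ (fun v => christoffel G k i j v) u := by
  have h : ∀ l, ContDiffAt ℝ ∞ (fun v => pd i (fun v => G v j l) v + pd j (fun v => G v i l) v
      - pd l (fun v => G v i j) v) u := by
    have := hG.contDiffAt u hu
    intro l
    fun_prop
  simp only [christoffel, Fin.sum_univ_two]
  exact contDiffAt_const.mul (((hG.contDiffAt_inv hu k 0).mul (h 0)).add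
    ((hG.contDiffAt_inv hu k 1).mul (h 1)))

theorem contDiffAt_riemann (hG : IsMetricOn G U) (hu : u ∈ U) (a b c d : Fin 2) :
    ContDiffAt ℝ ∞ (fun v => riemann G a b c d v) u := by
  have h1 := hG.contDiffAt_christoffel hu
  simp only [riemann, Fin.sum_univ_two]
  fun_prop

theorem contDiffAt_gauss (hG : IsMetricOn G U) (hu : u ∈ U) :
    ContDiffAt ℝ ∞ (fun v => gauss G v) u := by
  have h1 := hG.contDiffAt_riemann hu
  have h2 := hG.contDiffAt u hu
  have h3 := (hG.contDiffAt_det hu).inv (hG.det_ne_zero hu)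
  simp only [gauss, Fin.sum_univ_two, div_eq_mul_inv]
  exact ContDiffAt.mul (by fun_prop) h3

theorem christoffel_symm (hG : IsMetricOn G U) (hu : u ∈ U) (k i j : Fin 2) :
    christoffel G k i j u = christoffel G k j i u := by
  have h : ∀ l, pd l (fun v => G v i j) u = pd l (fun v => G v j i) u := fun l =>
    pd_congr hG.isOpen hu fun v hv => hG.symm v hv i j
  simp only [christoffel, h]
  congr 1
  refine Finset.sum_congr rfl fun l _ => ?_
  ring

theorem pd_symm (hG : IsMetricOn G U) (hu : u ∈ U) (l i j : Fin 2) :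
    pd l (fun v => G v i j) u = pd l (fun v => G v j i) u :=
  pd_congr hG.isOpen hu fun v hv => hG.symm v hv i j

/-- The Christoffel symbols of the first kind. -/
theorem sum_christoffel_mul (hG : IsMetricOn G U) (hu : u ∈ U) (m i j : Fin 2) :
    ∑ k, G u m k * christoffel G k i j u =
      (1 / 2 : ℝ) * (pd i (fun v => G v j m) u + pd j (fun v => G v i m) u
        - pd m (fun v => G v i j) u) := by
  have h : G u * (G u)⁻¹ = 1 := Matrix.mul_nonsing_inv _ (hG.det_ne_zero hu).isUnit
  have h' : ∀ l, G u m 0 * (G u)⁻¹ 0 l + G u m 1 * (G u)⁻¹ 1 l = if m = l then 1 else 0 := by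
    intro l
    have := congrFun (congrFun h m) l
    rwa [Matrix.mul_apply, Fin.sum_univ_two, Matrix.one_apply] at this
  have h0 := h' 0
  have h1 := h' 1
  simp only [christoffel, Fin.sum_univ_two]
  fin_cases m <;> simp at h0 h1 ⊢
  · linear_combination (1 / 2 : ℝ) * (pd i (fun v => G v j 0) u + pd j (fun v => G v i 0) u
        - pd 0 (fun v => G v i j) u) * h0
      + (1 / 2 : ℝ) * (pd i (fun v => G v j 1) u + pd j (fun v => G v i 1) u
        - pd 1 (fun v => G v i j) u) * h1
  · linear_combination (1 / 2 : ℝ) * (pd i (fun v => G v j 0) u + pd j (fun v => G v i 0) u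
        - pd 0 (fun v => G v i j) u) * h0
      + (1 / 2 : ℝ) * (pd i (fun v => G v j 1) u + pd j (fun v => G v i 1) u
        - pd 1 (fun v => G v i j) u) * h1

/-- The Levi-Civita connection is metric. -/
theorem pd_metric (hG : IsMetricOn G U) (hu : u ∈ U) (m i j : Fin 2) :
    pd m (fun v => G v i j) u = ∑ l, (christoffel G l m i u * G u l j
      + christoffel G l m j u * G u i l) := by
  have h1 := hG.sum_christoffel_mul hu j m i
  have h2 := hG.sum_christoffel_mul hu i m j
  simp only [Fin.sum_univ_two] at *
  rw [hG.symm u hu 0 j, hG.symm u hu 1 j]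
  linear_combination -h1 - h2 + (1 / 2 : ℝ) * hG.pd_symm hu m i j

/-- The Christoffel symbols are the only symmetric and metric connection coefficients. -/
theorem christoffel_unique (hG : IsMetricOn G U) (hu : u ∈ U) (A : Fin 2 → Fin 2 → Fin 2 → ℝ)
    (hA : ∀ k i j, A k i j = A k j i)
    (hA' : ∀ m i j, pd m (fun v => G v i j) u = ∑ l, (A l m i * G u l j + A l m j * G u i l))
    (k i j : Fin 2) : christoffel G k i j u = A k i j := by
  have h : (G u)⁻¹ * G u = 1 := Matrix.nonsing_inv_mul _ (hG.det_ne_zero hu).isUnit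
  have h' : ∀ l, (G u)⁻¹ k 0 * G u 0 l + (G u)⁻¹ k 1 * G u 1 l = if k = l then 1 else 0 := by
    intro l
    have := congrFun (congrFun h k) l
    rwa [Matrix.mul_apply, Fin.sum_univ_two, Matrix.one_apply] at this
  have h0 := h' 0
  have h1 := h' 1
  -- The Koszul combination of metric derivatives: compatibility and symmetry leave only the lowered
  -- `A`.
  have hB : ∀ l, pd i (fun v => G v j l) u + pd j (fun v => G v i l) u
      - pd l (fun v => G v i j) u = 2 * (G u l 0 * A 0 i j + G u l 1 * A 1 i j) := by
    intro l
    simp only [hA', Fin.sum_univ_two, hA _ j i, hA _ l, hG.symm u hu l]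
    rw [hG.symm u hu j 0, hG.symm u hu j 1]
    ring
  simp only [christoffel, hB, Fin.sum_univ_two]
  fin_cases k <;> simp at h0 h1 ⊢
  · linear_combination A 0 i j * h0 + A 1 i j * h1
  · linear_combination A 0 i j * h0 + A 1 i j * h1

end IsMetricOn
end LocalSurface

/-! ### The curvature tensor of a surface. -/

namespace LocalSurface
namespace IsMetricOn

variable {G : Plane → Matrix (Fin 2) (Fin 2) ℝ} {U : Set Plane} {u : Plane}

theorem pd_pd_metric (hG : IsMetricOn G U) (hu : u ∈ U) (n m i j : Fin 2) :
    pd n (pd m (fun v => G v i j)) u = ∑ l, (pd n (christoffel G l m i) u * G u l j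
      + christoffel G l m i u * pd n (fun v => G v l j) u
      + (pd n (christoffel G l m j) u * G u i l
        + christoffel G l m j u * pd n (fun v => G v i l) u)) := by
  have hΓ := hG.contDiffAt_christoffel hu
  have hg := hG.contDiffAt u hu
  rw [pd_congr hG.isOpen hu fun v hv => hG.pd_metric hv m i j]
  simp only [Fin.sum_univ_two]
  simp (disch := fun_prop) only [pd_add, pd_mul]

theorem riemann_self (a c d : Fin 2) : riemann G a a c d u = 0 := by
  simp [riemann]

theorem riemann_swap (a b c d : Fin 2) : riemann G a b c d u = -riemann G b a c d u := by
  simp only [riemann, Fin.sum_univ_two]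
  ring

/-- The Ricci identity for the parallel tensor `g`: it expresses that `∂_0` and `∂_1` commute on
`g_{ij}`. -/
theorem riemann_lower_antisymm (hG : IsMetricOn G U) (hu : u ∈ U) (i j : Fin 2) :
    ∑ l, (riemann G 0 1 i l u * G u l j + riemann G 0 1 j l u * G u i l) = 0 := by
  have h1 := hG.pd_pd_metric hu 0 1 i j
  have h2 := hG.pd_pd_metric hu 1 0 i j
  rw [pd_comm (hG.contDiffAt u hu i j), h2] at h1
  simp only [hG.pd_metric hu] at h1
  simp only [Fin.sum_univ_two, riemann, hG.christoffel_symm hu _ 1 0, hG.symm u hu 1 0] at h1 ⊢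
  revert h1
  fin_cases i <;> fin_cases j <;> simp only [Fin.zero_eta, Fin.mk_one,
    hG.christoffel_symm hu _ 1 0, hG.symm u hu 1 0] <;> intro h1 <;> linear_combination h1

/-- Skewness of the lowered tensor leaves one independent component, which is `gauss` times the
determinant; raising the index is Cramer's rule. -/
theorem riemann_zero_one (hG : IsMetricOn G U) (hu : u ∈ U) :
    riemann G 0 1 0 0 u = -(gauss G u * G u 0 1) ∧ riemann G 0 1 0 1 u = gauss G u * G u 0 0 ∧
    riemann G 0 1 1 0 u = -(gauss G u * G u 1 1) ∧ riemann G 0 1 1 1 u = gauss G u * G u 0 1 := by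
  have h00 := hG.riemann_lower_antisymm hu 0 0
  have h01 := hG.riemann_lower_antisymm hu 0 1
  have h11 := hG.riemann_lower_antisymm hu 1 1
  have hd := (hG.det_pos u hu).ne'
  have hk : gauss G u * (G u 0 0 * G u 1 1 - G u 0 1 * G u 0 1) =
      riemann G 0 1 0 0 u * G u 0 1 + riemann G 0 1 0 1 u * G u 1 1 := by
    rw [gauss, hG.det_eq hu, div_mul_cancel₀ _ hd, Fin.sum_univ_two]
  simp only [Fin.sum_univ_two, hG.symm u hu 1 0] at h00 h01 h11
  refine ⟨?_, ?_, ?_, ?_⟩ <;> apply mul_right_cancel₀ hd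
  · linear_combination (1/2 : ℝ) * G u 1 1 * h00 + G u 0 1 * hk
  · linear_combination -(1/2 : ℝ) * G u 0 1 * h00 - G u 0 0 * hk
  · linear_combination G u 1 1 * h01 - (1/2 : ℝ) * G u 0 1 * h11 + G u 1 1 * hk
  · linear_combination (1/2 : ℝ) * G u 0 0 * h11 - G u 0 1 * h01 - G u 0 1 * hk

/-- The curvature tensor of a surface is determined by the Gaussian curvature. -/
theorem riemann_eq (hG : IsMetricOn G U) (hu : u ∈ U) (a b c d : Fin 2) :
    riemann G a b c d u =
      gauss G u * (G u a c * (if d = b then 1 else 0) - (if d = a then 1 else 0) * G u b c) := by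
  obtain ⟨h1, h2, h3, h4⟩ := hG.riemann_zero_one hu
  have hs := hG.symm u hu 1 0
  fin_cases a <;> fin_cases b <;> fin_cases c <;> fin_cases d <;>
    simp [riemann_self, riemann_swap 1 0, h1, h2, h3, h4, hs]

end IsMetricOn
end LocalSurface

/-! ### The curvature of the connection on `W` and the bundle `V^(0)`. -/

namespace LocalSurface

/-- The components `f^{;k}` of the gradient of a function `f`. -/
def coordGrad (G : Plane → Matrix (Fin 2) (Fin 2) ℝ) (f : Plane → ℝ) (k : Fin 2) (u : Plane) : ℝ :=
  ∑ l, (G u)⁻¹ k l * pd l f u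

namespace IsMetricOn

variable {G : Plane → Matrix (Fin 2) (Fin 2) ℝ} {U : Set Plane} {u : Plane}

theorem contDiffAt_coordGrad (hG : IsMetricOn G U) (hu : u ∈ U) {f : Plane → ℝ}
    (hf : ContDiffAt ℝ ∞ f u) (k : Fin 2) : ContDiffAt ℝ ∞ (fun v => coordGrad G f k v) u := by
  simp only [coordGrad, Fin.sum_univ_two]
  exact ((hG.contDiffAt_inv hu k 0).mul (contDiffAt_pd hf)).add
    ((hG.contDiffAt_inv hu k 1).mul (contDiffAt_pd hf))

theorem sum_mul_coordGrad (hG : IsMetricOn G U) (hu : u ∈ U) (f : Plane → ℝ) (j : Fin 2) :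
    ∑ k, G u j k * coordGrad G f k u = pd j f u := by
  have h : G u * (G u)⁻¹ = 1 := Matrix.mul_nonsing_inv _ (hG.det_ne_zero hu).isUnit
  have h' : ∀ l, G u j 0 * (G u)⁻¹ 0 l + G u j 1 * (G u)⁻¹ 1 l = if j = l then 1 else 0 := by
    intro l
    have := congrFun (congrFun h j) l
    rwa [Matrix.mul_apply, Fin.sum_univ_two, Matrix.one_apply] at this
  have h0 := h' 0
  have h1 := h' 1
  simp only [coordGrad, Fin.sum_univ_two]
  fin_cases j <;> simp at h0 h1 ⊢ <;> linear_combination pd 0 f u * h0 + pd 1 f u * h1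

theorem eq_coordGrad (hG : IsMetricOn G U) (hu : u ∈ U) (f : Plane → ℝ) (A : Fin 2 → ℝ)
    (hA : ∀ j, ∑ k, G u j k * A k = pd j f u) (k : Fin 2) : A k = coordGrad G f k u := by
  have hA0 := hA 0
  have hA1 := hA 1
  rw [← hG.sum_mul_coordGrad hu] at hA0 hA1
  simp only [Fin.sum_univ_two, hG.symm u hu 1 0] at hA0 hA1
  have hd := (hG.det_pos u hu).ne'
  apply mul_right_cancel₀ hd
  fin_cases k <;> simp only [Fin.zero_eta, Fin.mk_one]
  · linear_combination G u 1 1 * hA0 - G u 0 1 * hA1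
  · linear_combination G u 0 0 * hA1 - G u 0 1 * hA0

theorem pd_riemann (hG : IsMetricOn G U) (hu : u ∈ U) (i a b c d : Fin 2) :
    pd i (riemann G a b c d) u =
      pd i (gauss G) u * (G u a c * (if d = b then 1 else 0) - (if d = a then 1 else 0) * G u b c)
      + gauss G u * (pd i (fun v => G v a c) u * (if d = b then 1 else 0)
        - (if d = a then 1 else 0) * pd i (fun v => G v b c) u) := by
  have hg := hG.contDiffAt u hu
  have hk := hG.contDiffAt_gauss hu
  rw [pd_congr hG.isOpen hu fun v hv => hG.riemann_eq hv a b c d]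
  simp (disch := fun_prop) only [pd_mul, pd_sub, pd_const]
  ring

theorem pd_christoffel_symm (hG : IsMetricOn G U) (hu : u ∈ U) (m k i j : Fin 2) :
    pd m (christoffel G k i j) u = pd m (christoffel G k j i) u :=
  pd_congr hG.isOpen hu fun _ hv => hG.christoffel_symm hv k i j

/-- A rewriting rule: trading `∂_1 Γ_{0c}` for `∂_0 Γ_{1c}` and curvature gives derivatives of
Christoffel symbols a normal form, so that `ring` sees the cancellations. -/
theorem pd_one_christoffel (c d : Fin 2) :
    pd 1 (christoffel G d 0 c) u = pd 0 (christoffel G d 1 c) u + riemann G 0 1 c d u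
      - ∑ e, (christoffel G e 0 c u * christoffel G d e 1 u
        - christoffel G e 1 c u * christoffel G d e 0 u) := by
  rw [riemann]
  ring

/-- The derivatives of `L` cancel in the commutator, and the terms in `K` add up to `R_{ija}^c +
R_{jai}^c + R_{aij}^c`, which is zero by the first Bianchi identity. -/
theorem curvW_fst (hG : IsMetricOn G U) (hu : u ∈ U) (w : Comp) (hw : ∀ a b, w.2 a b = -w.2 b a)
    (a : Fin 2) : (curvW G 0 1 u w).1 a = 0 := by
  have hΓ := hG.contDiffAt_christoffel hu
  have h00 : w.2 0 0 = 0 := by linarith [hw 0 0]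
  have h11 : w.2 1 1 = 0 := by linarith [hw 1 1]
  have h10 := hw 1 0
  simp only [curvW, nabla, covDeriv, covDeriv₂, Prod.fst_sub, Pi.sub_apply, Fin.sum_univ_two,
    pd_const]
  simp (disch := fun_prop) only [pd_sub, pd_add, pd_mul, pd_const, zero_sub, pd_neg]
  fin_cases a <;> simp only [Fin.zero_eta, Fin.mk_one, h00, h11, h10,
    hG.christoffel_symm hu _ 1 0, hG.pd_christoffel_symm hu _ _ 1 0, riemann,
    Fin.sum_univ_two] <;> ring

/-- All terms in `L` cancel because an area form is invariant under rotations. Only the covariant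
derivative of the curvature tensor, that is `dc`, paired with `K`, survives. -/
theorem curvW_snd (hG : IsMetricOn G U) (hu : u ∈ U) (w : Comp) (hw : ∀ a b, w.2 a b = -w.2 b a) :
    (curvW G 0 1 u w).2 0 0 = 0 ∧ (curvW G 0 1 u w).2 1 1 = 0 ∧
    (curvW G 0 1 u w).2 1 0 = -(curvW G 0 1 u w).2 0 1 ∧
    (curvW G 0 1 u w).2 0 1 = (G u 0 0 * G u 1 1 - G u 0 1 * G u 0 1) *
      ∑ k, coordGrad G (gauss G) k u * w.1 k := by
  have hΓ := hG.contDiffAt_christoffel hu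
  have hR := hG.contDiffAt_riemann hu
  have h00 : w.2 0 0 = 0 := by linarith [hw 0 0]
  have h11 : w.2 1 1 = 0 := by linarith [hw 1 1]
  have h10 := hw 1 0
  have hs := hG.symm u hu 1 0
  simp only [curvW, nabla, covDeriv, covDeriv₂, Prod.snd_sub, Pi.sub_apply, Fin.sum_univ_two,
    pd_const]
  simp (disch := fun_prop) only [pd_sub, pd_add, pd_mul, pd_const, zero_sub, pd_neg]
  simp only [hG.pd_riemann hu, hG.riemann_eq hu, hG.christoffel_symm hu _ 1 0,
    hG.pd_christoffel_symm hu _ _ 1 0, pd_one_christoffel, Fin.sum_univ_two, h00, h11, h10,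
    hs, hG.pd_metric hu, ← hG.sum_mul_coordGrad hu (gauss G), Fin.isValue, zero_ne_one, one_ne_zero,
    if_true, if_false]
  refine ⟨?_, ?_, ?_, ?_⟩ <;> ring

theorem mem_flagV_zero (hG : IsMetricOn G U) (hu : u ∈ U) (w : Comp) :
    w ∈ flagV G 0 u ↔ (∀ a b, w.2 a b = -w.2 b a) ∧ ∑ k, coordGrad G (gauss G) k u * w.1 k = 0 := by
  refine and_congr_right fun hw => ?_
  obtain ⟨h1, h2, h3, h4⟩ := hG.curvW_snd hu w hw
  have h5 := hG.curvW_fst hu w hw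
  constructor
  · intro h
    rw [h 0 1] at h4
    exact (mul_eq_zero.1 h4.symm).resolve_left (hG.det_pos u hu).ne'
  · intro h
    rw [h, mul_zero] at h4
    rw [h4] at h3
    have h01 : curvW G 0 1 u w = 0 := by
      ext a b
      · exact h5 a
      · fin_cases a <;> fin_cases b <;> simp [h1, h2, h3, h4]
    have h10 : curvW G 1 0 u w = 0 := by
      rw [show curvW G 1 0 u w = -curvW G 0 1 u w from (neg_sub _ _).symm, h01, neg_zero]
    intro i j
    fin_cases i <;> fin_cases j
    · exact sub_self _
    · exact h01
    · exact h10
    · exact sub_self _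

end IsMetricOn
end LocalSurface

/-! ### Killing forms, the bundle `V^(1)`, and the normalised gradient. -/

namespace LocalSurface

/-- The components `V^m V^k_{;m}`. -/
def selfDeriv (G : Plane → Matrix (Fin 2) (Fin 2) ℝ) (V : Fin 2 → Plane → ℝ) (k : Fin 2)
    (u : Plane) : ℝ :=
  ∑ m, V m u * (pd m (V k) u + ∑ l, christoffel G k m l u * V l u)

/-- The squared length `g(V, V)`. -/
def normSq (G : Plane → Matrix (Fin 2) (Fin 2) ℝ) (V : Fin 2 → Plane → ℝ) (u : Plane) : ℝ :=
  ∑ i, ∑ j, G u i j * V i u * V j u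

namespace IsMetricOn

variable {G : Plane → Matrix (Fin 2) (Fin 2) ℝ} {U : Set Plane} {u : Plane}

/-- Killing's identity `K_{a;bi} = R_{abi}^c K_c` for the one independent component. It follows from
the symmetry of the second derivatives of `K_0` (for `i = 0`) and `K_1` (for `i = 1`); the trace of
`Γ` appears because `K_{0;1}` is the coefficient of a 2-form. -/
theorem pd_killing (hG : IsMetricOn G U) (hu : u ∈ U) {K : Plane → Fin 2 → ℝ}
    (hK : ∀ v ∈ U, ∀ a, ContDiffAt ℝ ∞ (fun x => K x a) v)
    (hkill : ∀ v ∈ U, ∀ a b, covDeriv G K a b v + covDeriv G K b a v = 0) (i : Fin 2) :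
    pd i (covDeriv G K 0 1) u = (∑ c, christoffel G c i c u) * covDeriv G K 0 1 u +
      gauss G u * (G u 0 i * K u 1 - G u 1 i * K u 0) := by
  have hΓ := hG.contDiffAt_christoffel hu
  have hKu := hK u hu
  have hl : ContDiffAt ℝ ∞ (fun v => covDeriv G K 0 1 v) u := by
    simp only [covDeriv, Fin.sum_univ_two]
    fun_prop
  have h00 : ∀ v ∈ U, pd 0 (fun x => K x 0) v =
      christoffel G 0 0 0 v * K v 0 + christoffel G 1 0 0 v * K v 1 := by
    intro v hv
    have := hkill v hv 0 0
    simp only [covDeriv, Fin.sum_univ_two] at this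
    linear_combination (1 / 2 : ℝ) * this
  have h11 : ∀ v ∈ U, pd 1 (fun x => K x 1) v =
      christoffel G 0 1 1 v * K v 0 + christoffel G 1 1 1 v * K v 1 := by
    intro v hv
    have := hkill v hv 1 1
    simp only [covDeriv, Fin.sum_univ_two] at this
    linear_combination (1 / 2 : ℝ) * this
  have h01 : ∀ v ∈ U, pd 1 (fun x => K x 0) v = christoffel G 0 0 1 v * K v 0
      + christoffel G 1 0 1 v * K v 1 + covDeriv G K 0 1 v := by
    intro v hv
    simp only [covDeriv, Fin.sum_univ_two]
    ring
  have h10 : ∀ v ∈ U, pd 0 (fun x => K x 1) v = christoffel G 0 0 1 v * K v 0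
      + christoffel G 1 0 1 v * K v 1 - covDeriv G K 0 1 v := by
    intro v hv
    have h := hkill v hv 0 1
    have : covDeriv G K 1 0 v = pd 0 (fun x => K x 1) v
        - (christoffel G 0 0 1 v * K v 0 + christoffel G 1 0 1 v * K v 1) := by
      simp only [covDeriv, Fin.sum_univ_two, hG.christoffel_symm hv _ 1 0]
    linear_combination h - this
  have e0 := pd_comm (i := 1) (j := 0) (hKu 0)
  rw [pd_congr hG.isOpen hu h00, pd_congr hG.isOpen hu h01] at e0
  have e1 := pd_comm (i := 0) (j := 1) (hKu 1)
  rw [pd_congr hG.isOpen hu h11, pd_congr hG.isOpen hu h10] at e1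
  simp (disch := fun_prop) only [pd_sub, pd_add, pd_mul] at e0 e1
  rw [h00 u hu, h10 u hu, h01 u hu, h11 u hu] at e0 e1
  simp only [hG.pd_christoffel_symm hu _ _ 1 0, pd_one_christoffel, Fin.sum_univ_two,
    hG.riemann_eq hu, hG.christoffel_symm hu _ 1 0, hG.symm u hu 1 0, Fin.isValue, zero_ne_one,
    one_ne_zero, if_true, if_false] at e0 e1
  have hs := hG.symm u hu 1 0
  fin_cases i <;> simp only [Fin.zero_eta, Fin.mk_one, Fin.sum_univ_two,
    hG.christoffel_symm hu _ 1 0, hs]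
  · linear_combination -e0
  · linear_combination e1

/-- The integrability condition of `pd_killing`, from equality of the mixed second derivatives of
`K_{0;1}`. Geometrically, the Killing flow preserves `c`. -/
theorem killing_apply_grad_gauss (hG : IsMetricOn G U) (hu : u ∈ U) {K : Plane → Fin 2 → ℝ}
    (hK : ∀ v ∈ U, ∀ a, ContDiffAt ℝ ∞ (fun x => K x a) v)
    (hkill : ∀ v ∈ U, ∀ a b, covDeriv G K a b v + covDeriv G K b a v = 0) :
    ∑ k, coordGrad G (gauss G) k u * K u k = 0 := by
  have hΓ := hG.contDiffAt_christoffel hu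
  have hk := hG.contDiffAt_gauss hu
  have hg := hG.contDiffAt u hu
  have hKu := hK u hu
  have hl : ContDiffAt ℝ ∞ (fun v => covDeriv G K 0 1 v) u := by
    simp only [covDeriv, Fin.sum_univ_two]
    fun_prop
  have hpd : ∀ a b, pd b (fun x => K x a) u =
      (∑ c, christoffel G c a b u * K u c) + covDeriv G K a b u := by
    intro a b
    rw [covDeriv]
    ring
  have h00 : covDeriv G K 0 0 u = 0 := by linarith [hkill u hu 0 0]
  have h11 : covDeriv G K 1 1 u = 0 := by linarith [hkill u hu 1 1]
  have h10 : covDeriv G K 1 0 u = -covDeriv G K 0 1 u := by linarith [hkill u hu 0 1]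
  have e := pd_comm (i := 1) (j := 0) hl
  rw [pd_congr hG.isOpen hu fun v hv => hG.pd_killing hv hK hkill 0,
    pd_congr hG.isOpen hu fun v hv => hG.pd_killing hv hK hkill 1] at e
  simp only [Fin.sum_univ_two] at e
  simp (disch := fun_prop) only [pd_sub, pd_add, pd_mul] at e
  have hs := hG.symm u hu 1 0
  simp only [hG.pd_killing hu hK hkill, hpd, hG.pd_metric hu, h00, h11, h10,
    hG.pd_christoffel_symm hu _ _ 1 0, pd_one_christoffel, Fin.sum_univ_two,
    hG.riemann_eq hu, hG.christoffel_symm hu _ 1 0, hs, Fin.isValue, zero_ne_one,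
    one_ne_zero, if_true, if_false, ← hG.sum_mul_coordGrad hu (gauss G)] at e
  apply (mul_eq_zero.1 (?_ : (G u 0 0 * G u 1 1 - G u 0 1 * G u 0 1) * _ = 0)).resolve_left
    (hG.det_pos u hu).ne'
  rw [Fin.sum_univ_two]
  linear_combination e

/-- The prolongation of a Killing form is a parallel section of the derived flag. -/
theorem killing_mem_flagV_one (hG : IsMetricOn G U) (hu : u ∈ U) {K : Plane → Fin 2 → ℝ}
    (hK : ∀ v ∈ U, ∀ a, ContDiffAt ℝ ∞ (fun x => K x a) v)
    (hkill : ∀ v ∈ U, ∀ a b, covDeriv G K a b v + covDeriv G K b a v = 0) :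
    (K u, fun a b => covDeriv G K a b u) ∈ flagV G 1 u := by
  have h00 : ∀ v ∈ U, covDeriv G K 0 0 v = 0 := fun v hv => by linarith [hkill v hv 0 0]
  have h11 : ∀ v ∈ U, covDeriv G K 1 1 v = 0 := fun v hv => by linarith [hkill v hv 1 1]
  have h10 : ∀ v ∈ U, covDeriv G K 1 0 v = -covDeriv G K 0 1 v :=
    fun v hv => by linarith [hkill v hv 0 1]
  set s : Plane → Comp := fun v => (K v, fun a b => covDeriv G K a b v) with hs
  have hsmooth : ContDiffOn ℝ ∞ s U := by
    intro v hv
    have hKv := hK v hv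
    have hΓ := hG.contDiffAt_christoffel hv
    refine ContDiffAt.contDiffWithinAt (ContDiffAt.prodMk (contDiffAt_pi.2 hKv)
      (contDiffAt_pi.2 fun a => contDiffAt_pi.2 fun b => ?_))
    simp only [covDeriv, Fin.sum_univ_two]
    fun_prop
  have hmem : ∀ v ∈ U, s v ∈ flagV G 0 v := fun v hv =>
    (hG.mem_flagV_zero hv _).2 ⟨fun a b => by linarith [hkill v hv a b],
      hG.killing_apply_grad_gauss hv hK hkill⟩
  have hlevel : ∀ v ∈ U, s v ∈ level (flagV G 0) v := fun v hv =>
    ⟨s, ⟨U, hG.isOpen, hv, hsmooth, hmem⟩, rfl⟩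
  -- The T* component vanishes by the choice `L_{ab} = K_{a;b}`, and the Λ² component is Killing's
  -- identity.
  have hnabla : ∀ i, nabla G i s u = 0 := by
    intro i
    have hsym := hG.symm u hu 1 0
    have p0 := hG.pd_killing hu hK hkill i
    have q00 : pd i (fun v => covDeriv G K 0 0 v) u = 0 := by
      rw [pd_congr hG.isOpen hu h00, pd_const]
    have q11 : pd i (fun v => covDeriv G K 1 1 v) u = 0 := by
      rw [pd_congr hG.isOpen hu h11, pd_const]
    have q10 : pd i (fun v => covDeriv G K 1 0 v) u = -pd i (covDeriv G K 0 1) u := by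
      rw [pd_congr hG.isOpen hu h10, pd_neg]
    ext a b
    · simp [nabla, hs]
    · simp only [nabla, hs, covDeriv₂, Prod.snd_zero, Pi.zero_apply]
      fin_cases a <;> fin_cases b <;> simp only [Fin.zero_eta, Fin.mk_one, q00, q11, q10, p0,
        h00 u hu, h11 u hu, h10 u hu, Fin.sum_univ_two, hG.riemann_eq hu] <;>
      fin_cases i <;> simp [hG.christoffel_symm hu _ 1 0, hsym] <;> ring
  refine ⟨s, ⟨U, hG.isOpen, hu, hsmooth, hlevel⟩, rfl, fun i => ?_⟩
  rw [hnabla i]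
  refine ⟨fun _ => 0, ⟨U, hG.isOpen, hu, contDiffOn_const, fun v hv => ?_⟩, rfl⟩
  exact (hG.mem_flagV_zero hv _).2 ⟨by simp, by simp⟩

theorem level_subset (V : Plane → Set Comp) (u : Plane) : level V u ⊆ V u := by
  rintro w ⟨s, ⟨N, -, huN, -, hs⟩, rfl⟩
  exact hs u huN

/-- The conclusion says that `∇_V V` and `V = grad c` are linearly dependent: both are annihilated
by the nonzero covector `K` of `w = K + L`. -/
theorem selfDeriv_of_mem_flagV_one (hG : IsMetricOn G U) (hu : u ∈ U) {w : Comp}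
    (hw : w ∈ flagV G 1 u) (hw0 : w ≠ 0)
    (hV : coordGrad G (gauss G) 0 u ≠ 0 ∨ coordGrad G (gauss G) 1 u ≠ 0) :
    selfDeriv G (coordGrad G (gauss G)) 0 u * coordGrad G (gauss G) 1 u =
      selfDeriv G (coordGrad G (gauss G)) 1 u * coordGrad G (gauss G) 0 u := by
  obtain ⟨s, ⟨N, hN, huN, hs, hsN⟩, hsu, hnab⟩ := hw
  have hmem : ∀ v ∈ N ∩ U, s v ∈ flagV G 0 v := fun v hv => level_subset _ _ (hsN v hv.1)
  have hsAt : ContDiffAt ℝ ∞ s u := hs.contDiffAt (hN.mem_nhds huN)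
  have hK : ∀ k, ContDiffAt ℝ ∞ (fun v => (s v).1 k) u := fun k =>
    contDiffAt_pi.1 hsAt.fst k
  have hVs := hG.contDiffAt_coordGrad hu (hG.contDiffAt_gauss hu)
  have hpd : ∀ m, pd m (fun v => ∑ k, coordGrad G (gauss G) k v * (s v).1 k) u = 0 := by
    intro m
    rw [pd_congr (hN.inter hG.isOpen) ⟨huN, hu⟩ (g := fun _ => 0) fun v hv =>
      ((hG.mem_flagV_zero hv.2 _).1 (hmem v hv)).2, pd_const]
  have hnab' : ∀ m, _ := fun m => ((hG.mem_flagV_zero hu _).1 (level_subset _ _ (hnab m))).2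
  have hwmem := (hG.mem_flagV_zero hu _).1 (hmem u ⟨huN, hu⟩)
  rw [hsu] at hwmem
  obtain ⟨hskew, hKV⟩ := hwmem
  have h00 : w.2 0 0 = 0 := by linarith [hskew 0 0]
  have h11 : w.2 1 1 = 0 := by linarith [hskew 1 1]
  have h10 := hskew 1 0
  simp only [Fin.sum_univ_two] at hpd
  simp (disch := fun_prop) only [pd_add, pd_mul, hsu] at hpd
  simp only [nabla, covDeriv, Fin.sum_univ_two, hsu] at hnab'
  simp only [Fin.sum_univ_two] at hKV
  have p0 := hpd 0
  have p1 := hpd 1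
  have n0 := hnab' 0
  have n1 := hnab' 1
  simp only [h00, h11, h10, hG.christoffel_symm hu _ 1 0] at p0 p1 n0 n1
  simp only [selfDeriv, Fin.sum_univ_two, hG.christoffel_symm hu _ 1 0]
  generalize hV0 : coordGrad G (gauss G) 0 = V0 at *
  generalize hV1 : coordGrad G (gauss G) 1 = V1 at *
  -- Here `p` is the derivative of `K(V) = 0`, and `n` says that `∇s` lies in `V^(0)`. The
  -- difference contains only `K_a V^a_{;m}` and `L_{am} V^a`; contraction with `V^m` removes the
  -- latter.
  have hZ : w.1 0 * (V0 u * (pd 0 V0 u + (christoffel G 0 0 0 u * V0 u + christoffel G 0 0 1 u * V1 u))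
      + V1 u * (pd 1 V0 u + (christoffel G 0 0 1 u * V0 u + christoffel G 0 1 1 u * V1 u)))
      + w.1 1 * (V0 u * (pd 0 V1 u + (christoffel G 1 0 0 u * V0 u
        + christoffel G 1 0 1 u * V1 u))
      + V1 u * (pd 1 V1 u + (christoffel G 1 0 1 u * V0 u + christoffel G 1 1 1 u * V1 u))) = 0 := by
    linear_combination V0 u * (p0 - n0) + V1 u * (p1 - n1)
  -- If `K = 0`, the same difference reads `L_{am} V^a = 0`. As `V ≠ 0` and `L` has one independent
  -- component, `L = 0` too.
  have hKne : w.1 0 ≠ 0 ∨ w.1 1 ≠ 0 := by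
    by_contra! hc
    obtain ⟨c0, c1⟩ := hc
    have hL : w.2 0 1 = 0 := by
      rcases hV with h | h
      · apply (mul_eq_zero.1 (?_ : V0 u * w.2 0 1 = 0)).resolve_left h
        rw [c0, c1] at p1 n1
        linear_combination p1 - n1
      · apply (mul_eq_zero.1 (?_ : V1 u * w.2 0 1 = 0)).resolve_left h
        rw [c0, c1] at p0 n0
        linear_combination n0 - p0
    apply hw0
    ext a b
    · fin_cases a <;> simp [c0, c1]
    · fin_cases a <;> fin_cases b <;> simp [h00, h11, h10, hL]
  rcases hKne with h | h
  · apply mul_left_cancel₀ h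
    linear_combination V1 u * hZ - hKV * (V0 u * (pd 0 V1 u + (christoffel G 1 0 0 u * V0 u
        + christoffel G 1 0 1 u * V1 u))
      + V1 u * (pd 1 V1 u + (christoffel G 1 0 1 u * V0 u + christoffel G 1 1 1 u * V1 u)))
  · apply mul_left_cancel₀ h
    linear_combination -V0 u * hZ + hKV * (V0 u * (pd 0 V0 u + (christoffel G 0 0 0 u * V0 u + christoffel G 0 0 1 u * V1 u))
      + V1 u * (pd 1 V0 u + (christoffel G 0 0 1 u * V0 u + christoffel G 0 1 1 u * V1 u)))

theorem normSq_pos (hG : IsMetricOn G U) (hu : u ∈ U) {V : Fin 2 → Plane → ℝ}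
    (hV : V 0 u ≠ 0 ∨ V 1 u ≠ 0) : 0 < normSq G V u := by
  have h0 := hG.pos u hu
  have hd := hG.det_pos u hu
  apply pos_of_mul_pos_right (?_ : 0 < G u 0 0 * _) h0.le
  simp only [normSq, Fin.sum_univ_two, hG.symm u hu 1 0]
  -- Completing the square after multiplication by `g_{00} > 0`.
  rw [show G u 0 0 * (G u 0 0 * V 0 u * V 0 u + G u 0 1 * V 0 u * V 1 u
      + (G u 0 1 * V 1 u * V 0 u + G u 1 1 * V 1 u * V 1 u)) =
      (G u 0 0 * V 0 u + G u 0 1 * V 1 u) ^ 2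
      + (G u 0 0 * G u 1 1 - G u 0 1 * G u 0 1) * V 1 u ^ 2 by ring]
  by_cases h1 : V 1 u = 0
  · have h2 : V 0 u ≠ 0 := hV.resolve_right (not_not.2 h1)
    have : 0 < (G u 0 0 * V 0 u) ^ 2 := by positivity
    simpa [h1] using this
  · positivity

theorem contDiffAt_normSq (hG : IsMetricOn G U) (hu : u ∈ U) {V : Fin 2 → Plane → ℝ}
    (hV : ∀ k, ContDiffAt ℝ ∞ (V k) u) : ContDiffAt ℝ ∞ (fun v => normSq G V v) u := by
  have := hG.contDiffAt u hu
  simp only [normSq, Fin.sum_univ_two]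
  fun_prop

theorem contDiffAt_inv_sqrt_normSq (hG : IsMetricOn G U) (hu : u ∈ U) {V : Fin 2 → Plane → ℝ}
    (hV : ∀ k, ContDiffAt ℝ ∞ (V k) u) (hV0 : V 0 u ≠ 0 ∨ V 1 u ≠ 0) :
    ContDiffAt ℝ ∞ (fun v => (√(normSq G V v))⁻¹) u := by
  have h := hG.normSq_pos hu hV0
  exact ((hG.contDiffAt_normSq hu hV).sqrt h.ne').inv (Real.sqrt_pos.2 h).ne'

/-- If `∇_V V` is proportional to `V`, then the normalization of `V` is autoparallel. -/
theorem selfDeriv_normalize (hG : IsMetricOn G U) (hu : u ∈ U) {V : Fin 2 → Plane → ℝ}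
    (hV : ∀ v ∈ U, ∀ k, ContDiffAt ℝ ∞ (V k) v) (hV0 : ∀ v ∈ U, V 0 v ≠ 0 ∨ V 1 v ≠ 0)
    (h : selfDeriv G V 0 u * V 1 u = selfDeriv G V 1 u * V 0 u) (k : Fin 2) :
    selfDeriv G (fun k v => V k v * (√(normSq G V v))⁻¹) k u = 0 := by
  have hf := hG.contDiffAt_inv_sqrt_normSq hu (hV u hu) (hV0 u hu)
  have hq := hG.contDiffAt_normSq hu (hV u hu)
  have hVu := hV u hu
  have hg := hG.contDiffAt u hu
  set f : Plane → ℝ := fun v => (√(normSq G V v))⁻¹ with hfdef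
  change selfDeriv G (fun k v => V k v * f v) k u = 0
  have hqpos := hG.normSq_pos hu (hV0 u hu)
  have hff : ∀ v ∈ U, f v * f v * normSq G V v = 1 := by
    intro v hv
    have := hG.normSq_pos hv (hV0 v hv)
    have h1 := (Real.sqrt_pos.2 this).ne'
    simp only [hfdef]
    field_simp
    rw [Real.sq_sqrt this.le]
  have hfu : f u ≠ 0 := by
    intro h0
    have := hff u hu
    simp [h0] at this
  -- The derivative of `f² |V|² = 1`, which determines `df` through the derivative of `|V|²`.
  have hpf : ∀ m, 2 * pd m f u * normSq G V u + f u * pd m (normSq G V) u = 0 := by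
    intro m
    have e := pd_congr (i := m) hG.isOpen hu hff
    simp (disch := fun_prop) only [pd_mul, pd_const] at e
    apply mul_left_cancel₀ hfu
    linear_combination e
  have hpq : ∀ m, pd m (normSq G V) u = pd m (fun v => ∑ i, ∑ j, G v i j * V i v * V j v) u :=
    fun _ => rfl
  simp only [Fin.sum_univ_two] at hpq
  simp (disch := fun_prop) only [pd_mul, pd_add] at hpq
  have hs := hG.symm u hu 1 0
  simp only [hG.pd_metric hu, Fin.sum_univ_two, hs] at hpq
  have f0 := hpf 0
  have f1 := hpf 1
  rw [hpq] at f0 f1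
  apply mul_left_cancel₀ hqpos.ne'
  simp only [selfDeriv]
  simp (disch := fun_prop) only [pd_mul]
  simp only [normSq, selfDeriv, Fin.sum_univ_two, hG.christoffel_symm hu _ 1 0, hs] at *
  fin_cases k <;> simp only [Fin.zero_eta, Fin.mk_one]
  -- The `f0`, `f1` terms cancel the component of `∇_V V` along `V` against the derivative of the
  -- length; `h` removes the component across `V`.
  · linear_combination (1 / 2 : ℝ) * f u * V 0 u * (V 0 u * f0 + V 1 u * f1)
      + f u ^ 2 * (G u 0 1 * V 0 u + G u 1 1 * V 1 u) * h
  · linear_combination (1 / 2 : ℝ) * f u * V 1 u * (V 0 u * f0 + V 1 u * f1)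
      - f u ^ 2 * (G u 0 0 * V 0 u + G u 0 1 * V 1 u) * h

end IsMetricOn
end LocalSurface

/-! ### Invariance of the Gaussian curvature under isometries. -/

namespace LocalSurface

/-- The Jacobian matrix `∂_i φ^a`. -/
def jac (φ : Plane → Plane) (a i : Fin 2) (u : Plane) : ℝ := pd i (fun v => φ v a) u

theorem pd_jac_comm {φ : Plane → Plane} {u : Plane} (hφ : ContDiffAt ℝ ∞ φ u) (a i m : Fin 2) :
    pd m (jac φ a i) u = pd i (jac φ a m) u := by
  have h : ContDiffAt ℝ ∞ (fun v => φ v a) u := contDiffAt_euclidean.1 hφ a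
  exact pd_comm h

theorem contDiffAt_jac {φ : Plane → Plane} {u : Plane} (hφ : ContDiffAt ℝ ∞ φ u) (a i : Fin 2) :
    ContDiffAt ℝ ∞ (fun v => jac φ a i v) u :=
  contDiffAt_pd (contDiffAt_euclidean.1 hφ a)

/-- `φ` is an isometry from `U` with the metric `G` to `U'` with the metric `G'`. -/
structure IsIsometryOn (G G' : Plane → Matrix (Fin 2) (Fin 2) ℝ) (U U' : Set Plane)
    (φ : Plane → Plane) : Prop where
  left : IsMetricOn G U
  right : IsMetricOn G' U'
  contDiffAt : ∀ u ∈ U, ContDiffAt ℝ ∞ φ u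
  mapsTo : ∀ u ∈ U, φ u ∈ U'
  metric_eq : ∀ u ∈ U, ∀ i j, G u i j = ∑ a, ∑ b, jac φ a i u * jac φ b j u * G' (φ u) a b

namespace IsIsometryOn

variable {G G' : Plane → Matrix (Fin 2) (Fin 2) ℝ} {U U' : Set Plane} {φ : Plane → Plane}
  {u : Plane}

theorem det_ne_zero (h : IsIsometryOn G G' U U' φ) (hu : u ∈ U) :
    jac φ 0 0 u * jac φ 1 1 u - jac φ 0 1 u * jac φ 1 0 u ≠ 0 := by
  intro hd
  have h1 := (h.left.det_pos u hu).ne'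
  have hs := h.right.symm _ (h.mapsTo u hu) 1 0
  apply h1
  simp only [h.metric_eq u hu, Fin.sum_univ_two, hs]
  linear_combination (jac φ 0 0 u * jac φ 1 1 u - jac φ 0 1 u * jac φ 1 0 u) *
    (G' (φ u) 0 0 * G' (φ u) 1 1 - G' (φ u) 0 1 ^ 2) * hd

theorem pd_comp_metric (h : IsIsometryOn G G' U U' φ) (hu : u ∈ U) (m a b : Fin 2) :
    pd m (fun v => G' (φ v) a b) u = pd 0 (fun v => G' v a b) (φ u) * jac φ 0 m u
      + pd 1 (fun v => G' v a b) (φ u) * jac φ 1 m u :=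
  pd_comp (h.right.contDiffAt _ (h.mapsTo u hu) a b) (h.contDiffAt u hu)

/-- The transformation law of the Christoffel symbols. -/
theorem sum_jac_mul_christoffel (h : IsIsometryOn G G' U U' φ) (hu : u ∈ U) (c i j : Fin 2) :
    ∑ k, jac φ c k u * christoffel G k i j u =
      (∑ a, ∑ b, christoffel G' c a b (φ u) * jac φ a i u * jac φ b j u)
        + pd i (jac φ c j) u := by
  have hφu := h.mapsTo u hu
  have hφ := h.contDiffAt u hu
  have hd := h.det_ne_zero hu
  set D := jac φ 0 0 u * jac φ 1 1 u - jac φ 0 1 u * jac φ 1 0 u with hD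
  obtain ⟨T, hT⟩ : ∃ T : Fin 2 → Fin 2 → Fin 2 → ℝ, ∀ c i j, T c i j =
    (∑ a, ∑ b, christoffel G' c a b (φ u) * jac φ a i u * jac φ b j u)
        + pd i (jac φ c j) u := ⟨_, fun _ _ _ => rfl⟩
  -- Cramer's rule for `J A = T`: `A` is the pulled-back connection. It is symmetric and compatible
  -- with `G`, so uniqueness identifies it with the Christoffel symbols of `G`.
  obtain ⟨A, hA0, hA1⟩ : ∃ A : Fin 2 → Fin 2 → Fin 2 → ℝ,
      (∀ i j, A 0 i j = (jac φ 1 1 u * T 0 i j - jac φ 0 1 u * T 1 i j) / D) ∧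
      (∀ i j, A 1 i j = (jac φ 0 0 u * T 1 i j - jac φ 1 0 u * T 0 i j) / D) :=
    ⟨fun k i j => if k = 0 then (jac φ 1 1 u * T 0 i j - jac φ 0 1 u * T 1 i j) / D
      else (jac φ 0 0 u * T 1 i j - jac φ 1 0 u * T 0 i j) / D, by simp, by simp⟩
  have hJA0 : ∀ i j, jac φ 0 0 u * A 0 i j + jac φ 0 1 u * A 1 i j = T 0 i j := by
    intro i j
    rw [hA0, hA1]
    field_simp
    rw [hD]
    ring
  have hJA1 : ∀ i j, jac φ 1 0 u * A 0 i j + jac φ 1 1 u * A 1 i j = T 1 i j := by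
    intro i j
    rw [hA0, hA1]
    field_simp
    rw [hD]
    ring
  have hTs : ∀ c i j, T c i j = T c j i := by
    intro c i j
    simp only [hT, Fin.sum_univ_two, pd_jac_comm hφ c j i, h.right.christoffel_symm hφu _ 1 0]
    ring
  have hJs := contDiffAt_jac hφ
  have hg' : ∀ a b, ContDiffAt ℝ ∞ (fun v => G' (φ v) a b) u := fun a b =>
    (h.right.contDiffAt _ hφu a b).comp u hφ
  have hΓ : ∀ k i j, christoffel G k i j u = A k i j := by
    refine h.left.christoffel_unique hu A (fun k i j => ?_) fun m i j => ?_
    · fin_cases k <;> simp only [Fin.zero_eta, Fin.mk_one, hA0, hA1, hTs _ i j]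
    · obtain ⟨H, hH⟩ : ∃ H : Fin 2 → Fin 2 → Plane → ℝ, ∀ a b, H a b = fun v => G' (φ v) a b :=
        ⟨_, fun _ _ => rfl⟩
      have hHs : ∀ a b, ContDiffAt ℝ ∞ (H a b) u := fun a b => by rw [hH]; exact hg' a b
      have hGH : ∀ v ∈ U, G v i j = ∑ a, ∑ b, jac φ a i v * jac φ b j v * H a b v := by
        simpa only [hH] using fun v hv => h.metric_eq v hv i j
      rw [pd_congr h.left.isOpen hu hGH]
      simp only [Fin.sum_univ_two]
      simp (disch := fun_prop) only [pd_mul, pd_add]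
      simp only [hH]
      have e0i := hJA0 m i
      have e1i := hJA1 m i
      have e0j := hJA0 m j
      have e1j := hJA1 m j
      simp only [hT, Fin.sum_univ_two] at e0i e1i e0j e1j
      simp only [h.metric_eq u hu, h.pd_comp_metric hu, h.right.pd_metric hφu, Fin.sum_univ_two,
        h.right.symm _ hφu 1 0, h.right.christoffel_symm hφu _ 1 0] at e0i e1i e0j e1j ⊢
      linear_combination
        -(jac φ 0 j u * G' (φ u) 0 0 + jac φ 1 j u * G' (φ u) 0 1) * e0i
        - (jac φ 0 j u * G' (φ u) 0 1 + jac φ 1 j u * G' (φ u) 1 1) * e1i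
        - (jac φ 0 i u * G' (φ u) 0 0 + jac φ 1 i u * G' (φ u) 0 1) * e0j
        - (jac φ 0 i u * G' (φ u) 0 1 + jac φ 1 i u * G' (φ u) 1 1) * e1j
  simp only [hΓ]
  rw [← hT, Fin.sum_univ_two]
  fin_cases c
  · exact hJA0 i j
  · exact hJA1 i j

/-- The transformation law of the curvature tensor. -/
theorem sum_jac_mul_riemann (h : IsIsometryOn G G' U U' φ) (hu : u ∈ U) (c j : Fin 2) :
    ∑ k, jac φ c k u * riemann G 0 1 j k u =
      (jac φ 0 0 u * jac φ 1 1 u - jac φ 0 1 u * jac φ 1 0 u) *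
        ∑ b, riemann G' 0 1 b c (φ u) * jac φ b j u := by
  have hφu := h.mapsTo u hu
  have hφ := h.contDiffAt u hu
  have hJs := contDiffAt_jac hφ
  have hΓ := h.left.contDiffAt_christoffel hu
  have hΓ' : ∀ k i j, ContDiffAt ℝ ∞ (fun v => christoffel G' k i j (φ v)) u := fun k i j =>
    (h.right.contDiffAt_christoffel hφu k i j).comp u hφ
  have hpΓ' : ∀ m k i j, pd m (fun v => christoffel G' k i j (φ v)) u =
      pd 0 (christoffel G' k i j) (φ u) * jac φ 0 m u
      + pd 1 (christoffel G' k i j) (φ u) * jac φ 1 m u := fun m k i j =>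
    pd_comp (h.right.contDiffAt_christoffel hφu k i j) hφ
  -- The Christoffel law is differentiated in both directions. In the difference the second
  -- derivatives of the Jacobian cancel (`e2`), and its first derivatives are eliminated by the law
  -- itself (`t`).
  have e0 := pd_congr (i := 1) h.left.isOpen hu fun v hv => h.sum_jac_mul_christoffel hv c 0 j
  have e1 := pd_congr (i := 0) h.left.isOpen hu fun v hv => h.sum_jac_mul_christoffel hv c 1 j
  have e2 : pd 1 (pd 0 (jac φ c j)) u = pd 0 (pd 1 (jac φ c j)) u := pd_comm (hJs c j)
  simp only [Fin.sum_univ_two] at e0 e1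
  simp (disch := fun_prop) only [pd_mul, pd_add, hpΓ'] at e0 e1
  have t : ∀ a i j, pd i (jac φ a j) u = _ := fun a i j =>
    eq_sub_of_add_eq' (h.sum_jac_mul_christoffel hu a i j).symm
  rw [e2] at e0
  simp only [t, Fin.sum_univ_two, h.left.christoffel_symm hu _ 1 0,
    h.right.christoffel_symm hφu _ 1 0, h.right.pd_christoffel_symm hφu _ _ 1 0] at e0 e1
  simp only [riemann, Fin.sum_univ_two, h.left.christoffel_symm hu _ 1 0,
    h.right.christoffel_symm hφu _ 1 0, h.right.pd_christoffel_symm hφu _ _ 1 0]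
  fin_cases j <;> simp only [Fin.zero_eta, Fin.mk_one, h.left.christoffel_symm hu _ 1 0,
    h.left.pd_christoffel_symm hu _ _ 1 0] at e0 e1 ⊢ <;> linear_combination e0 - e1

/-- The Gaussian curvature is invariant under isometries. -/
theorem gauss_eq (h : IsIsometryOn G G' U U' φ) (hu : u ∈ U) : gauss G u = gauss G' (φ u) := by
  have hφu := h.mapsTo u hu
  have hd := h.det_ne_zero hu
  have e0 := h.sum_jac_mul_riemann hu 0 0
  have e1 := h.sum_jac_mul_riemann hu 1 0
  have hp := (h.left.pos u hu).ne'
  have hg := h.metric_eq u hu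
  simp only [h.left.riemann_eq hu, h.right.riemann_eq hφu, Fin.sum_univ_two, Fin.isValue,
    zero_ne_one, one_ne_zero, if_true, if_false, h.left.symm u hu 1 0, hg,
    h.right.symm _ hφu 1 0] at e0 e1 hp
  apply mul_left_cancel₀ (mul_ne_zero hd hp)
  -- This combination equates the two curvatures after multiplication by `det J · g_{00}`.
  linear_combination jac φ 0 0 u * e1 - jac φ 1 0 u * e0

end IsIsometryOn
end LocalSurface

/-! ### Smoothness and positivity of the metric in charts. -/

namespace SurfaceMetric

open LocalSurface

variable {M : Type*} [TopologicalSpace M] [ChartedSpace Plane M] [IsManifold (𝓡 2) ∞ M]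
  {g : SurfaceMetric M} {e e' : OpenPartialHomeomorph M Plane} {u : Plane}

theorem contMDiffAt_symm (he : e ∈ IsManifold.maximalAtlas (𝓡 2) ∞ M) (hu : u ∈ e.target) :
    ContMDiffAt (𝓡 2) (𝓡 2) ∞ e.symm u :=
  contMDiffAt_symm_of_mem_maximalAtlas he hu

theorem contMDiffAt_coordVec (he : e ∈ IsManifold.maximalAtlas (𝓡 2) ∞ M) (hu : u ∈ e.target)
    (i : Fin 2) : ContMDiffAt (𝓡 2) (𝓡 2).tangent ∞
      (fun v => (⟨e.symm v, coordVec e i v⟩ : TangentBundle (𝓡 2) M)) u := by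
  have h1 : ContMDiffOn (𝓡 2).tangent (𝓡 2).tangent ∞ (tangentMapWithin (𝓡 2) (𝓡 2) e.symm e.target)
      (Bundle.TotalSpace.proj ⁻¹' e.target) :=
    (contMDiffOn_symm_of_mem_maximalAtlas he).contMDiffOn_tangentMapWithin (by simp)
      e.open_target.uniqueMDiffOn
  have h2 : ContMDiffOn (𝓡 2) (𝓡 2).tangent ∞
      (fun v => (⟨v, EuclideanSpace.single i (1 : ℝ)⟩ : TangentBundle (𝓡 2) Plane)) e.target :=
    contMDiffOn_vectorSpace_iff_contDiffOn.2 contDiffOn_const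
  have h3 := h1.comp h2 (fun v hv => hv)
  refine (h3.congr fun v hv => ?_).contMDiffAt (e.open_target.mem_nhds hu)
  simp only [Function.comp, tangentMapWithin, coordVec]
  rw [mfderivWithin_of_isOpen e.open_target hv]

theorem contDiffAt_inner (g : SurfaceMetric M) (he : e ∈ IsManifold.maximalAtlas (𝓡 2) ∞ M)
    (hu : u ∈ e.target) {Y Z : ∀ v : Plane, TangentSpace (𝓡 2) (e.symm v)}
    (hY : ContMDiffAt (𝓡 2) (𝓡 2).tangent ∞
      (fun v => (⟨e.symm v, Y v⟩ : TangentBundle (𝓡 2) M)) u)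
    (hZ : ContMDiffAt (𝓡 2) (𝓡 2).tangent ∞
      (fun v => (⟨e.symm v, Z v⟩ : TangentBundle (𝓡 2) M)) u) :
    ContDiffAt ℝ ∞ (fun v => g.inner (e.symm v) (Y v) (Z v)) u := by
  rw [← contMDiffAt_iff_contDiffAt]
  have h : ContMDiffAt (𝓡 2) ((𝓡 2).prod 𝓘(ℝ, ℝ)) ∞ (fun v =>
      Bundle.TotalSpace.mk' ℝ (E := Bundle.Trivial M ℝ) (e.symm v)
        (g.inner (e.symm v) (Y v) (Z v))) u := by
    apply ContMDiffAt.clm_bundle_apply₂ (F₁ := Plane) (F₂ := Plane)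
    · exact (g.contMDiff (e.symm u)).comp u (contMDiffAt_symm he hu)
    · exact hY
    · exact hZ
  simp only [Bundle.contMDiffAt_totalSpace] at h
  exact h.2

theorem contDiffAt_inChart (g : SurfaceMetric M) (he : e ∈ IsManifold.maximalAtlas (𝓡 2) ∞ M)
    (hu : u ∈ e.target) (i j : Fin 2) : ContDiffAt ℝ ∞ (fun v => g.inChart e v i j) u :=
  g.contDiffAt_inner he hu (contMDiffAt_coordVec he hu i) (contMDiffAt_coordVec he hu j)

theorem mdifferentiableAt_symm (he : e ∈ IsManifold.maximalAtlas (𝓡 2) ∞ M) (hu : u ∈ e.target) :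
    MDifferentiableAt (𝓡 2) (𝓡 2) e.symm u :=
  (contMDiffAt_symm he hu).mdifferentiableAt (by simp)

theorem mdifferentiable (he : e ∈ IsManifold.maximalAtlas (𝓡 2) ∞ M) :
    e.MDifferentiable (𝓡 2) (𝓡 2) :=
  ⟨(contMDiffOn_of_mem_maximalAtlas he).mdifferentiableOn (by simp),
    (contMDiffOn_symm_of_mem_maximalAtlas he).mdifferentiableOn (by simp)⟩

theorem mfderiv_symm_apply (v : Plane) :
    mfderiv (𝓡 2) (𝓡 2) e.symm u v = v 0 • coordVec e 0 u + v 1 • coordVec e 1 u := by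
  have h : (v : Plane) = v 0 • EuclideanSpace.single 0 (1 : ℝ) + v 1 • EuclideanSpace.single 1 1 := by
    conv_lhs => rw [plane_eq_sum v, Fin.sum_univ_two]
  have h2 := congrArg (fun w : Plane => mfderiv (𝓡 2) (𝓡 2) e.symm u w) h
  refine h2.trans ?_
  exact ((mfderiv (𝓡 2) (𝓡 2) e.symm u).map_add _ _).trans
    (congrArg₂ _ ((mfderiv (𝓡 2) (𝓡 2) e.symm u).map_smul _ _)
      ((mfderiv (𝓡 2) (𝓡 2) e.symm u).map_smul _ _))

theorem coordVec_combination_ne_zero (he : e ∈ IsManifold.maximalAtlas (𝓡 2) ∞ M)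
    (hu : u ∈ e.target) {v : Plane} (hv : v ≠ 0) :
    v 0 • coordVec e 0 u + v 1 • coordVec e 1 u ≠ 0 := by
  rw [← mfderiv_symm_apply]
  intro h
  have hinj := (mdifferentiable he).symm.mfderiv_injective (x := u) hu
  apply hv
  apply hinj
  exact h.trans (mfderiv (𝓡 2) (𝓡 2) e.symm u).map_zero.symm

theorem isMetricOn (g : SurfaceMetric M) (he : e ∈ IsManifold.maximalAtlas (𝓡 2) ∞ M) :
    IsMetricOn (g.inChart e) e.target where
  isOpen := e.open_target
  contDiffAt u hu := g.contDiffAt_inChart he hu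
  symm u _ i j := g.symm _ _ _
  pos u hu := by
    have h := coordVec_combination_ne_zero he hu (v := EuclideanSpace.single 0 1) (by simp)
    simp at h
    exact g.pos _ _ h
  det_pos u hu := by
    have h0 : 0 < g.inChart e u 0 0 := by
      have h := coordVec_combination_ne_zero he hu (v := EuclideanSpace.single 0 1) (by simp)
      simp at h
      exact g.pos _ _ h
    -- The vector `-g_{01} ∂_0 + g_{00} ∂_1` is orthogonal to `∂_0`, and its squared length is
    -- `g_{00}` times the determinant.
    have h := coordVec_combination_ne_zero he hu
      (v := !₂[-g.inChart e u 0 1, g.inChart e u 0 0]) (by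
        intro h
        have := congrArg (fun w : Plane => w 1) h
        simp at this
        exact h0.ne' this)
    have h2 := g.pos _ _ h
    have hs : g.inner (e.symm u) (coordVec e 1 u) (coordVec e 0 u) = g.inChart e u 0 1 := g.symm _ _ _
    have h00 : g.inner (e.symm u) (coordVec e 0 u) (coordVec e 0 u) = g.inChart e u 0 0 := rfl
    have h01 : g.inner (e.symm u) (coordVec e 0 u) (coordVec e 1 u) = g.inChart e u 0 1 := rfl
    have h11 : g.inner (e.symm u) (coordVec e 1 u) (coordVec e 1 u) = g.inChart e u 1 1 := rfl
    simp only [map_add, map_smul, add_apply, smul_apply, hs, h00, h01, h11, smul_eq_mul] at h2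
    simp at h2
    apply pos_of_mul_pos_right _ h0.le
    linarith

end SurfaceMetric

/-! ### Chart independence of the curvature and of its gradient. -/

namespace SurfaceMetric

open LocalSurface

variable {M : Type*} [TopologicalSpace M] [ChartedSpace Plane M] [IsManifold (𝓡 2) ∞ M]
  {g : SurfaceMetric M} {e e' : OpenPartialHomeomorph M Plane} {u : Plane}

/-- The metric with its tangent vectors regarded as vectors of the model plane. -/
def innerPlane (g : SurfaceMetric M) (x : M) : Plane →L[ℝ] Plane →L[ℝ] ℝ := g.inner x

/-- The coordinate vectors regarded as vectors of the model plane. -/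
def coordVecPlane (e : OpenPartialHomeomorph M Plane) (i : Fin 2) (u : Plane) : Plane :=
  coordVec e i u

/-- The differential of a function regarded as a linear form on the model plane. -/
def diffPlane (f : M → ℝ) (x : M) : Plane →L[ℝ] ℝ := mfderiv (𝓡 2) 𝓘(ℝ, ℝ) f x

/-- The components of a tangent vector in a chart. -/
def chartVec (e : OpenPartialHomeomorph M Plane) (x : M) (v : TangentSpace (𝓡 2) x) : Plane :=
  mfderiv (𝓡 2) (𝓡 2) e x v

theorem contDiffAt_transition (he : e ∈ IsManifold.maximalAtlas (𝓡 2) ∞ M)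
    (he' : e' ∈ IsManifold.maximalAtlas (𝓡 2) ∞ M) (hu : u ∈ e.target)
    (hu' : e.symm u ∈ e'.source) : ContDiffAt ℝ ∞ (fun v => e' (e.symm v)) u := by
  rw [← contMDiffAt_iff_contDiffAt]
  exact (contMDiffAt_of_mem_maximalAtlas he' hu').comp u (contMDiffAt_symm he hu)

theorem coordVec_transition (he : e ∈ IsManifold.maximalAtlas (𝓡 2) ∞ M)
    (he' : e' ∈ IsManifold.maximalAtlas (𝓡 2) ∞ M) (hu : u ∈ e.target)
    (hu' : e.symm u ∈ e'.source) (i : Fin 2) :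
    coordVecPlane e i u = jac (fun v => e' (e.symm v)) 0 i u • coordVecPlane e' 0 (e' (e.symm u))
      + jac (fun v => e' (e.symm v)) 1 i u • coordVecPlane e' 1 (e' (e.symm u)) := by
  set φ : Plane → Plane := fun v => e' (e.symm v) with hφ
  have hφs := contDiffAt_transition he he' hu hu'
  have hφd : DifferentiableAt ℝ φ u := hφs.differentiableAt (by simp)
  have hev : e.symm =ᶠ[𝓝 u] e'.symm ∘ φ := by
    have h1 : e.symm ⁻¹' e'.source ∈ 𝓝 u :=
      (e.continuousAt_symm hu).preimage_mem_nhds (e'.open_source.mem_nhds hu')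
    filter_upwards [h1] with v hv
    exact (e'.left_inv hv).symm
  have hφu : φ u ∈ e'.target := e'.map_source hu'
  have h2 := mfderiv_comp u (mdifferentiableAt_symm he' hφu)
    (mdifferentiableAt_iff_differentiableAt.2 hφd)
  have h3 : (mfderiv (𝓡 2) (𝓡 2) e.symm u : Plane →L[ℝ] Plane) =
      mfderiv (𝓡 2) (𝓡 2) (e'.symm ∘ φ) u := hev.mfderiv_eq
  have h4 : coordVecPlane e i u = (mfderiv (𝓡 2) (𝓡 2) e'.symm (φ u) : Plane →L[ℝ] Plane)
      (fderiv ℝ φ u (EuclideanSpace.single i 1)) := by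
    rw [← mfderiv_eq_fderiv]
    change (mfderiv (𝓡 2) (𝓡 2) e.symm u : Plane →L[ℝ] Plane) _ = _
    rw [h3]
    exact congrArg (fun L : Plane →L[ℝ] Plane => L (EuclideanSpace.single i 1)) h2
  have h5 : ∀ a, fderiv ℝ φ u (EuclideanSpace.single i 1) a = jac φ a i u := by
    intro a
    have := ((EuclideanSpace.proj a : Plane →L[ℝ] ℝ).hasFDerivAt.comp u hφd.hasFDerivAt).fderiv
    unfold jac pd
    change _ = fderiv ℝ ((EuclideanSpace.proj a : Plane →L[ℝ] ℝ) ∘ φ) u _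
    rw [this]
    rfl
  rw [h4, ← h5, ← h5]
  exact mfderiv_symm_apply (e := e') _

theorem isIsometryOn_transition (g : SurfaceMetric M) (he : e ∈ IsManifold.maximalAtlas (𝓡 2) ∞ M)
    (he' : e' ∈ IsManifold.maximalAtlas (𝓡 2) ∞ M) :
    IsIsometryOn (g.inChart e) (g.inChart e') (e.target ∩ e.symm ⁻¹' e'.source) e'.target
      (fun v => e' (e.symm v)) where
  left :=
    { isOpen := e.symm.isOpen_inter_preimage e'.open_source
      contDiffAt := fun u hu => (g.isMetricOn he).contDiffAt u hu.1
      symm := fun u hu => (g.isMetricOn he).symm u hu.1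
      pos := fun u hu => (g.isMetricOn he).pos u hu.1
      det_pos := fun u hu => (g.isMetricOn he).det_pos u hu.1 }
  right := g.isMetricOn he'
  contDiffAt u hu := contDiffAt_transition he he' hu.1 hu.2
  mapsTo u hu := e'.map_source hu.2
  metric_eq u hu i j := by
    have h1 : g.inChart e u i j =
      g.innerPlane (e.symm u) (coordVecPlane e i u) (coordVecPlane e j u) := rfl
    have h2 : ∀ a b, g.inChart e' (e' (e.symm u)) a b =
      g.innerPlane (e'.symm (e' (e.symm u))) (coordVecPlane e' a (e' (e.symm u)))
        (coordVecPlane e' b (e' (e.symm u))) := fun _ _ => rfl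
    -- The base point can be rewritten because `innerPlane` takes its arguments in the fixed space
    -- `Plane` rather than in a tangent space depending on the point.
    have h3 : e'.symm (e' (e.symm u)) = e.symm u := e'.left_inv hu.2
    simp only [h1, h2, h3, Fin.sum_univ_two, coordVec_transition he he' hu.1 hu.2, map_add,
      map_smul, add_apply, smul_apply, smul_eq_mul]
    ring

/-- The Gaussian curvature may be computed in any chart. -/
theorem gaussianCurvature_eq (g : SurfaceMetric M) (he : e ∈ IsManifold.maximalAtlas (𝓡 2) ∞ M)
    {x : M} (hx : x ∈ e.source) : g.gaussianCurvature x = gauss (g.inChart e) (e x) := by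
  have h := (g.isIsometryOn_transition he (IsManifold.chart_mem_maximalAtlas x)).gauss_eq
    (u := e x) ⟨e.map_source hx, by simp [e.left_inv hx]⟩
  rw [h, e.left_inv hx]
  rfl

theorem mdifferentiableAt_gaussianCurvature (g : SurfaceMetric M) (x : M) :
    MDifferentiableAt (𝓡 2) 𝓘(ℝ, ℝ) g.gaussianCurvature x := by
  have he : chartAt Plane x ∈ IsManifold.maximalAtlas (𝓡 2) ∞ M :=
    IsManifold.chart_mem_maximalAtlas x
  have hx := mem_chart_source Plane x
  have h1 : ContDiffAt ℝ ∞ (gauss (g.inChart (chartAt Plane x))) (chartAt Plane x x) :=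
    (g.isMetricOn he).contDiffAt_gauss ((chartAt Plane x).map_source hx)
  have h2 : MDifferentiableAt (𝓡 2) 𝓘(ℝ, ℝ)
      (gauss (g.inChart (chartAt Plane x)) ∘ chartAt Plane x) x :=
    (mdifferentiableAt_iff_differentiableAt.2 h1.differentiableAt_infty).comp x
      ((mdifferentiable he).mdifferentiableAt hx)
  refine h2.congr_of_eventuallyEq ?_
  filter_upwards [(chartAt Plane x).open_source.mem_nhds hx] with y hy
  exact g.gaussianCurvature_eq he hy

theorem diffPlane_gaussianCurvature (g : SurfaceMetric M)
    (he : e ∈ IsManifold.maximalAtlas (𝓡 2) ∞ M) (hu : u ∈ e.target) (i : Fin 2) :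
    diffPlane g.gaussianCurvature (e.symm u) (coordVecPlane e i u) =
      pd i (gauss (g.inChart e)) u := by
  have h1 := mfderiv_comp u (g.mdifferentiableAt_gaussianCurvature (e.symm u))
    (mdifferentiableAt_symm he hu)
  have h2 : g.gaussianCurvature ∘ e.symm =ᶠ[𝓝 u] gauss (g.inChart e) := by
    filter_upwards [e.open_target.mem_nhds hu] with v hv
    rw [Function.comp, g.gaussianCurvature_eq he (e.map_target hv), e.right_inv hv]
  have h3 : fderiv ℝ (g.gaussianCurvature ∘ e.symm) u = _ := mfderiv_eq_fderiv.symm.trans h1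
  unfold pd
  rw [← h2.fderiv_eq, h3]
  rfl

theorem eq_chartVec (he : e ∈ IsManifold.maximalAtlas (𝓡 2) ∞ M) {x : M} (hx : x ∈ e.source)
    (X : TangentSpace (𝓡 2) x) : (show Plane from X) = chartVec e x X 0 • coordVecPlane e 0 (e x)
      + chartVec e x X 1 • coordVecPlane e 1 (e x) := by
  have h := (mdifferentiable he).symm_comp_deriv hx
  have h' := congrArg (fun L : Plane →L[ℝ] Plane => L X) h
  exact h'.symm.trans (mfderiv_symm_apply (e := e) (u := e x) (chartVec e x X))

theorem inChart_apply (g : SurfaceMetric M) {x : M} (hx : x ∈ e.source) (a b : Fin 2) :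
    g.inChart e (e x) a b =
      g.innerPlane x (coordVecPlane e a (e x)) (coordVecPlane e b (e x)) := by
  have : g.inChart e (e x) a b =
    g.innerPlane (e.symm (e x)) (coordVecPlane e a (e x)) (coordVecPlane e b (e x)) := rfl
  rw [this, e.left_inv hx]

theorem innerPlane_coordVec (g : SurfaceMetric M) (he : e ∈ IsManifold.maximalAtlas (𝓡 2) ∞ M)
    {x : M} (hx : x ∈ e.source) (X : TangentSpace (𝓡 2) x) (j : Fin 2) :
    g.innerPlane x X (coordVecPlane e j (e x)) =
      ∑ k, g.inChart e (e x) j k * chartVec e x X k := by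
  have hu : e x ∈ e.target := e.map_source hx
  refine (congrArg (fun Y => g.innerPlane x Y (coordVecPlane e j (e x)))
    (eq_chartVec he hx X)).trans ?_
  rw [Fin.sum_univ_two, (g.isMetricOn he).symm _ hu j 0,
    (g.isMetricOn he).symm _ hu j 1, g.inChart_apply hx, g.inChart_apply hx]
  simp only [map_add, map_smul, add_apply, smul_apply, smul_eq_mul]
  ring

theorem chartVec_eq_coordGrad (g : SurfaceMetric M) (he : e ∈ IsManifold.maximalAtlas (𝓡 2) ∞ M)
    {x : M} (hx : x ∈ e.source) (X : TangentSpace (𝓡 2) x) (f : M → ℝ) (F : Plane → ℝ)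
    (hX : ∀ w : Plane, g.innerPlane x X w = diffPlane f x w)
    (hF : ∀ j, diffPlane f (e.symm (e x)) (coordVecPlane e j (e x)) = pd j F (e x)) (k : Fin 2) :
    chartVec e x X k = coordGrad (g.inChart e) F k (e x) := by
  refine (g.isMetricOn he).eq_coordGrad (e.map_source hx) _
    (fun k => chartVec e x X k) (fun j => ?_) k
  rw [← hF, ← g.innerPlane_coordVec he hx X, e.left_inv hx, hX]

/-- The gradient of the curvature, in coordinates. -/
theorem chartVec_grad_gaussianCurvature (g : SurfaceMetric M)
    (he : e ∈ IsManifold.maximalAtlas (𝓡 2) ∞ M) {x : M} (hx : x ∈ e.source) (k : Fin 2) :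
    chartVec e x (g.grad g.gaussianCurvature x) k =
      coordGrad (g.inChart e) (gauss (g.inChart e)) k (e x) :=
  g.chartVec_eq_coordGrad he hx _ _ _ (g.inner_grad g.gaussianCurvature x)
    (g.diffPlane_gaussianCurvature he (e.map_source hx)) k

end SurfaceMetric

/-! ### Consequences of the constant ranks. -/

namespace LocalSurface

/-- The fibre of `W = T* ⊕ Λ² T*`. -/
def skewComp : Submodule ℝ Comp where
  carrier := {w | ∀ a b, w.2 a b = -w.2 b a}
  add_mem' {v w} hv hw a b := by
    simp only [Prod.snd_add, Pi.add_apply]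
    rw [hv a b, hw a b]
    ring
  zero_mem' a b := by simp
  smul_mem' r w hw a b := by
    simp only [Prod.smul_snd, Pi.smul_apply, smul_eq_mul]
    rw [hw a b]
    ring

/-- The pairing of the one-form component with a vector. -/
def pairing (V : Fin 2 → ℝ) : Comp →ₗ[ℝ] ℝ where
  toFun w := ∑ k, V k * w.1 k
  map_add' v w := by
    simp only [Prod.fst_add, Pi.add_apply, Fin.sum_univ_two]
    ring
  map_smul' r w := by
    simp only [Prod.smul_fst, Pi.smul_apply, smul_eq_mul, Fin.sum_univ_two, RingHom.id_apply]
    ring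

theorem skewComp_inf_ker_lt {V : Fin 2 → ℝ} (hV : V 0 ≠ 0 ∨ V 1 ≠ 0) :
    skewComp ⊓ LinearMap.ker (pairing V) < skewComp := by
  refine lt_of_le_of_ne inf_le_left fun h => ?_
  -- The one-form with the same components as `V` pairs with `V` to a positive sum of squares.
  have h1 : ((V, 0) : Comp) ∈ skewComp := fun a b => by simp
  rw [← h] at h1
  have h2 : ∑ k, V k * V k = 0 := h1.2
  rw [Fin.sum_univ_two] at h2
  rcases hV with h | h
  · have := mul_self_pos.2 h
    nlinarith [mul_self_nonneg (V 1)]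
  · have := mul_self_pos.2 h
    nlinarith [mul_self_nonneg (V 0)]

theorem IsMetricOn.flagV_zero_eq {G : Plane → Matrix (Fin 2) (Fin 2) ℝ} {U : Set Plane} {u : Plane}
    (hG : IsMetricOn G U) (hu : u ∈ U) :
    flagV G 0 u = ↑(skewComp ⊓ LinearMap.ker (pairing fun k => coordGrad G (gauss G) k u)) := by
  ext w
  exact hG.mem_flagV_zero hu w

theorem exists_ne_zero_of_finrank_ne_zero {s : Set Comp} (hs : Set.finrank ℝ s ≠ 0) :
    ∃ w ∈ s, w ≠ 0 := by
  by_contra! h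
  apply hs
  rw [Set.finrank, Submodule.span_eq_bot.2 h, finrank_bot]

theorem finrank_ne_zero_of_ne_zero_mem {s : Set Comp} {w : Comp} (hw : w ∈ s) (h0 : w ≠ 0) :
    Set.finrank ℝ s ≠ 0 := by
  intro h
  rw [Set.finrank, Submodule.finrank_eq_zero] at h
  exact h0 (Submodule.span_eq_bot.1 h w hw)

end LocalSurface

namespace SurfaceMetric

open LocalSurface

variable {M : Type*} [TopologicalSpace M] [ChartedSpace Plane M] [IsManifold (𝓡 2) ∞ M]
  {g : SurfaceMetric M} {e : OpenPartialHomeomorph M Plane} {u : Plane}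

/-- The components of the gradient of the Gaussian curvature in a chart. -/
def gradComp (g : SurfaceMetric M) (e : OpenPartialHomeomorph M Plane) (k : Fin 2) (u : Plane) : ℝ :=
  coordGrad (g.inChart e) (gauss (g.inChart e)) k u

theorem contDiffAt_gradComp (g : SurfaceMetric M) (he : e ∈ IsManifold.maximalAtlas (𝓡 2) ∞ M)
    (hu : u ∈ e.target) (k : Fin 2) : ContDiffAt ℝ ∞ (g.gradComp e k) u :=
  (g.isMetricOn he).contDiffAt_coordGrad hu ((g.isMetricOn he).contDiffAt_gauss hu) k

/-- On a regular surface the gradient of the curvature vanishes everywhere or nowhere. -/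
theorem IsRegular.gradComp_eq_zero_or_ne_zero (hreg : g.IsRegular) :
    (∀ e ∈ IsManifold.maximalAtlas (𝓡 2) ∞ M, ∀ u ∈ e.target,
      g.gradComp e 0 u = 0 ∧ g.gradComp e 1 u = 0) ∨
    (∀ e ∈ IsManifold.maximalAtlas (𝓡 2) ∞ M, ∀ u ∈ e.target,
      g.gradComp e 0 u ≠ 0 ∨ g.gradComp e 1 u ≠ 0) := by
  obtain ⟨r, hr⟩ := hreg 0
  have key : ∀ e ∈ IsManifold.maximalAtlas (𝓡 2) ∞ M, ∀ u ∈ e.target,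
      Module.finrank ℝ ↥(skewComp ⊓ LinearMap.ker (pairing fun k => g.gradComp e k u)) = r := by
    intro e he u hu
    have h := (hr e he u hu).2
    rwa [(g.isMetricOn he).flagV_zero_eq hu, Set.finrank, Submodule.span_eq] at h
  -- The constant rank is that of the whole fibre exactly when the pairing with the gradient is
  -- zero, so one point decides for all charts and points.
  by_cases hr3 : r = Module.finrank ℝ skewComp
  · left
    intro e he u hu
    by_contra hne
    have hne' : g.gradComp e 0 u ≠ 0 ∨ g.gradComp e 1 u ≠ 0 := by tauto
    have hlt := Submodule.finrank_lt_finrank_of_lt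
      (skewComp_inf_ker_lt (V := fun k => g.gradComp e k u) hne')
    rw [key e he u hu] at hlt
    exact hlt.ne hr3
  · right
    intro e he u hu
    by_contra! h0
    apply hr3
    have h1 : (pairing fun k => g.gradComp e k u) = 0 := by
      ext w <;> simp [pairing, h0.1, h0.2]
    have h2 := key e he u hu
    rw [h1, LinearMap.ker_zero, inf_top_eq] at h2
    exact h2.symm

/-- At a point where `X ≠ 0`, the prolongation of the dual form is nonzero already in its one-form
component, as the metric is nondegenerate. -/
theorem IsKilling.exists_flagV_one_ne_zero {X : ∀ x : M, TangentSpace (𝓡 2) x}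
    (hX : g.IsKilling X) (hX0 : ∃ x, X x ≠ 0) :
    ∃ e ∈ IsManifold.maximalAtlas (𝓡 2) ∞ M, ∃ u ∈ e.target,
      ∃ w ∈ flagV (g.inChart e) 1 u, w ≠ 0 := by
  obtain ⟨x, hx⟩ := hX0
  have he : chartAt Plane x ∈ IsManifold.maximalAtlas (𝓡 2) ∞ M :=
    IsManifold.chart_mem_maximalAtlas x
  have hxs := mem_chart_source Plane x
  set e := chartAt Plane x with he_def
  have hu : e x ∈ e.target := e.map_source hxs
  refine ⟨e, he, e x, hu, _, (g.isMetricOn he).killing_mem_flagV_one hu (fun v hv a => ?_)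
    (fun v hv a b => hX.2 e he v hv a b), fun h0 => ?_⟩
  · exact g.contDiffAt_inner he hv ((hX.1 (e.symm v)).comp v (contMDiffAt_symm he hv))
      (contMDiffAt_coordVec he hv a)
  · have h1 := congrArg Prod.fst h0
    have h2 : ∀ a, g.innerPlane (e.symm (e x)) (X (e.symm (e x))) (coordVecPlane e a (e x)) = 0 :=
      fun a => congrFun h1 a
    rw [e.left_inv hxs] at h2
    have h3 : g.innerPlane x (X x) (X x) = 0 := by
      refine (congrArg (g.innerPlane x (X x)) (eq_chartVec he hxs (X x))).trans ?_
      rw [map_add, map_smul, map_smul, h2, h2]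
      simp
    exact (g.pos x (X x) hx).ne' h3

/-- On a regular surface with a Killing field, the normalized gradient of a nonconstant curvature
is autoparallel. -/
theorem IsRegular.selfDeriv_normalized_grad (hreg : g.IsRegular)
    {X : ∀ x : M, TangentSpace (𝓡 2) x} (hX : g.IsKilling X) (hX0 : ∃ x, X x ≠ 0)
    (hV : ∀ e ∈ IsManifold.maximalAtlas (𝓡 2) ∞ M, ∀ u ∈ e.target,
      g.gradComp e 0 u ≠ 0 ∨ g.gradComp e 1 u ≠ 0)
    (he : e ∈ IsManifold.maximalAtlas (𝓡 2) ∞ M) (hu : u ∈ e.target) (k : Fin 2) :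
    selfDeriv (g.inChart e)
      (fun k v => g.gradComp e k v * (√(normSq (g.inChart e) (g.gradComp e) v))⁻¹) k u = 0 := by
  obtain ⟨r, hr⟩ := hreg 1
  obtain ⟨e₀, he₀, u₀, hu₀, w₀, hw₀, hw₀'⟩ := hX.exists_flagV_one_ne_zero hX0
  -- Constancy of the rank carries nonvanishing of `V^(1)` from one point to all, including the
  -- zeros of `X` and other components of `M`.
  have hr0 : r ≠ 0 := by
    rw [← (hr e₀ he₀ u₀ hu₀).2]
    exact finrank_ne_zero_of_ne_zero_mem hw₀ hw₀'
  rw [← (hr e he u hu).2] at hr0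
  obtain ⟨w, hw, hw0⟩ := exists_ne_zero_of_finrank_ne_zero hr0
  exact (g.isMetricOn he).selfDeriv_normalize hu (fun v hv k => g.contDiffAt_gradComp he hv k)
    (hV e he) ((g.isMetricOn he).selfDeriv_of_mem_flagV_one hu hw hw0 (hV e he u hu)) k

end SurfaceMetric

/-! ### Integral curves in charts, and geodesics. -/

namespace SurfaceMetric

open LocalSurface

variable {M : Type*} [TopologicalSpace M] [ChartedSpace Plane M] [IsManifold (𝓡 2) ∞ M]
  {g : SurfaceMetric M} {e : OpenPartialHomeomorph M Plane} {u : Plane}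

/-- `c` is on `S` a solution of the differential equation with right-hand side `F e` in each
chart `e`. -/
def SolvesOn (F : OpenPartialHomeomorph M Plane → Fin 2 → Plane → ℝ) (c : ℝ → M) (S : Set ℝ) :
    Prop :=
  ContinuousOn c S ∧ ∀ e ∈ IsManifold.maximalAtlas (𝓡 2) ∞ M, ∀ t ∈ S, c t ∈ e.source →
    HasDerivAt (fun τ => e (c τ)) (WithLp.toLp 2 fun k => F e k (e (c t))) t

/-- Bootstrapping: if `x` is of class `C^n`, then so is its derivative `F ∘ x`, and `x` is of class
`C^(n+1)`. -/
theorem contDiffOn_of_hasDerivAt {x : ℝ → Plane} {F : Plane → Plane} {S : Set ℝ} {U : Set Plane}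
    (hS : IsOpen S) (hF : ContDiffOn ℝ ∞ F U) (hxU : ∀ t ∈ S, x t ∈ U)
    (hx : ∀ t ∈ S, HasDerivAt x (F (x t)) t) : ContDiffOn ℝ ∞ x S := by
  rw [contDiffOn_infty]
  intro n
  induction n with
  | zero => exact contDiffOn_zero.2 fun t ht => (hx t ht).continuousAt.continuousWithinAt
  | succ n ih =>
    push_cast
    rw [contDiffOn_succ_iff_deriv_of_isOpen hS]
    refine ⟨fun t ht => (hx t ht).differentiableAt.differentiableWithinAt, by simp, ?_⟩
    exact ((hF.of_le (by exact_mod_cast le_top)).comp ih hxU).congr fun t ht => (hx t ht).deriv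

theorem SolvesOn.contDiffOn_chart {F : OpenPartialHomeomorph M Plane → Fin 2 → Plane → ℝ}
    {c : ℝ → M} {S : Set ℝ} (hc : SolvesOn F c S) (hS : IsOpen S)
    (hF : ∀ e ∈ IsManifold.maximalAtlas (𝓡 2) ∞ M, ∀ u ∈ e.target, ∀ k, ContDiffAt ℝ ∞ (F e k) u)
    (he : e ∈ IsManifold.maximalAtlas (𝓡 2) ∞ M) :
    ContDiffOn ℝ ∞ (fun τ => e (c τ)) (S ∩ c ⁻¹' e.source) := by
  refine contDiffOn_of_hasDerivAt (F := fun v => WithLp.toLp 2 fun k => F e k v) (U := e.target)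
    (hc.1.isOpen_inter_preimage hS e.open_source) (fun u hu => ?_)
    (fun t ht => e.map_source ht.2) (fun t ht => hc.2 e he t ht.1 ht.2)
  exact (contDiffAt_euclidean.2 fun k => hF e he u hu k).contDiffWithinAt

theorem SolvesOn.contMDiffOn {F : OpenPartialHomeomorph M Plane → Fin 2 → Plane → ℝ}
    {c : ℝ → M} {S : Set ℝ} (hc : SolvesOn F c S) (hS : IsOpen S)
    (hF : ∀ e ∈ IsManifold.maximalAtlas (𝓡 2) ∞ M, ∀ u ∈ e.target, ∀ k,
      ContDiffAt ℝ ∞ (F e k) u) :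
    ContMDiffOn 𝓘(ℝ, ℝ) (𝓡 2) ∞ c S := by
  intro t ht
  have he : chartAt Plane (c t) ∈ IsManifold.maximalAtlas (𝓡 2) ∞ M :=
    IsManifold.chart_mem_maximalAtlas _
  have hxs := mem_chart_source Plane (c t)
  set e := chartAt Plane (c t)
  have hO : S ∩ c ⁻¹' e.source ∈ 𝓝 t :=
    (hc.1.isOpen_inter_preimage hS e.open_source).mem_nhds ⟨ht, hxs⟩
  have h1 : ContMDiffAt 𝓘(ℝ, ℝ) (𝓡 2) ∞ (fun τ => e (c τ)) t :=
    contMDiffAt_iff_contDiffAt.2 ((hc.contDiffOn_chart hS hF he).contDiffAt hO)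
  have h2 : ContMDiffAt 𝓘(ℝ, ℝ) (𝓡 2) ∞ (fun τ => e.symm (e (c τ))) t :=
    (contMDiffAt_symm he (e.map_source hxs)).comp t h1
  refine (h2.congr_of_eventuallyEq ?_).contMDiffWithinAt
  filter_upwards [hO] with τ hτ
  exact (e.left_inv hτ.2).symm

/-- Integral curves of an autoparallel vector field are geodesics. -/
theorem SolvesOn.isGeodesicOn {F : OpenPartialHomeomorph M Plane → Fin 2 → Plane → ℝ}
    {c : ℝ → M} {S : Set ℝ} (hc : SolvesOn F c S) (hS : IsOpen S)
    (hF : ∀ e ∈ IsManifold.maximalAtlas (𝓡 2) ∞ M, ∀ u ∈ e.target, ∀ k, ContDiffAt ℝ ∞ (F e k) u)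
    (hpar : ∀ e ∈ IsManifold.maximalAtlas (𝓡 2) ∞ M, ∀ u ∈ e.target, ∀ k,
      selfDeriv (g.inChart e) (F e) k u = 0) :
    g.IsGeodesicOn c S := by
  refine ⟨hc.contMDiffOn hS hF, fun e he t ht hts k => ?_⟩
  have hO := hc.1.isOpen_inter_preimage hS e.open_source
  have hd : ∀ τ ∈ S ∩ c ⁻¹' e.source, ∀ k, HasDerivAt (fun τ => e (c τ) k) (F e k (e (c τ))) τ :=
    fun τ hτ k => (EuclideanSpace.proj k : Plane →L[ℝ] ℝ).hasFDerivAt.comp_hasDerivAt τ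
      (hc.2 e he τ hτ.1 hτ.2)
  have hd1 : ∀ k, deriv (fun τ => e (c τ) k) t = F e k (e (c t)) :=
    fun k => (hd t ⟨ht, hts⟩ k).deriv
  have hd2 : deriv (fun τ => e (c τ) k) =ᶠ[𝓝 t] fun τ => F e k (e (c τ)) := by
    filter_upwards [hO.mem_nhds ⟨ht, hts⟩] with τ hτ using (hd τ hτ k).deriv
  -- The acceleration is the derivative of `F` along itself; with the Christoffel term it becomes
  -- `selfDeriv`.
  have hd3 : deriv (fun τ => F e k (e (c τ))) t =
      ∑ m, F e m (e (c t)) * pd m (F e k) (e (c t)) := by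
    have h1 := (hF e he _ (e.map_source hts) k).differentiableAt_infty.hasFDerivAt
    have h2 := h1.comp_hasDerivAt t (hc.2 e he t ht hts)
    exact h2.deriv.trans (fderiv_apply_eq_sum _ _ _)
  rw [hd2.deriv_eq, hd3]
  simp only [hd1]
  have h := hpar e he _ (e.map_source hts) k
  simp only [selfDeriv, Fin.sum_univ_two] at h ⊢
  linear_combination h

theorem hasDerivAt_chart (he : e ∈ IsManifold.maximalAtlas (𝓡 2) ∞ M) {γ : ℝ → M} {t : ℝ}
    (ht : γ t ∈ e.source) {X : TangentSpace (𝓡 2) (γ t)}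
    (hγ : HasMFDerivAt 𝓘(ℝ, ℝ) (𝓡 2) γ t ((1 : ℝ →L[ℝ] ℝ).smulRight X)) :
    HasDerivAt (fun τ => e (γ τ)) (chartVec e (γ t) X) t := by
  have h1 := ((mdifferentiable he).mdifferentiableAt ht).hasMFDerivAt.comp t hγ
  obtain ⟨L, hL, hL1⟩ : ∃ L : ℝ →L[ℝ] Plane, HasFDerivAt (fun τ => e (γ τ)) L t ∧
      L 1 = chartVec e (γ t) X :=
    ⟨_, hasMFDerivAt_iff_hasFDerivAt.1 h1, congrArg (mfderiv (𝓡 2) (𝓡 2) e (γ t)) (one_smul ℝ X)⟩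
  exact hL1 ▸ hL.hasDerivAt

theorem solvesOn_gradComp {γ : ℝ → M} {J : Set ℝ} (hJ : IsOpen J)
    (hγ : IsMIntegralCurveOn γ (g.grad g.gaussianCurvature) J) : SolvesOn g.gradComp γ J := by
  have h : ∀ t ∈ J, HasMFDerivAt 𝓘(ℝ, ℝ) (𝓡 2) γ t _ :=
    fun t ht => (hγ t ht).hasMFDerivAt (hJ.mem_nhds ht)
  refine ⟨fun t ht => (h t ht).continuousAt.continuousWithinAt, fun e he t ht hts => ?_⟩
  refine (hasDerivAt_chart he hts (h t ht)).congr_deriv ?_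
  ext k
  exact g.chartVec_grad_gaussianCurvature he hts k

/-- The length of the gradient of the Gaussian curvature. -/
def gradNorm (g : SurfaceMetric M) (x : M) : ℝ :=
  √(g.innerPlane x (g.grad g.gaussianCurvature x) (g.grad g.gaussianCurvature x))

theorem innerPlane_self (g : SurfaceMetric M) (he : e ∈ IsManifold.maximalAtlas (𝓡 2) ∞ M)
    {x : M} (hx : x ∈ e.source) (X : TangentSpace (𝓡 2) x) {V : Fin 2 → Plane → ℝ}
    (hV : ∀ k, chartVec e x X k = V k (e x)) :
    g.innerPlane x X X = normSq (g.inChart e) V (e x) := by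
  refine (congrArg (g.innerPlane x X) (eq_chartVec he hx X)).trans ?_
  rw [map_add, map_smul, map_smul, g.innerPlane_coordVec he hx, g.innerPlane_coordVec he hx]
  simp only [hV, normSq, Fin.sum_univ_two, smul_eq_mul]
  ring

theorem gradNorm_eq (g : SurfaceMetric M) (he : e ∈ IsManifold.maximalAtlas (𝓡 2) ∞ M)
    {x : M} (hx : x ∈ e.source) :
    g.gradNorm x = √(normSq (g.inChart e) (g.gradComp e) (e x)) := by
  rw [gradNorm, g.innerPlane_self he hx _ fun k => g.chartVec_grad_gaussianCurvature he hx k]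
  rfl

/-- The derivative of the inverse of an injective function with nonvanishing derivative. -/
theorem hasDerivAt_invFunOn {φ h : ℝ → ℝ} {J : Set ℝ} (hJ : IsOpen J) (hinj : Set.InjOn φ J)
    (hφ : ∀ t ∈ J, HasStrictDerivAt φ (h t) t) (hpos : ∀ t ∈ J, h t ≠ 0) :
    IsOpen (φ '' J) ∧
      ∀ t ∈ J, HasDerivAt (Function.invFunOn φ J) (h t)⁻¹ (φ t) := by
  have hinv : ∀ t ∈ J, Function.invFunOn φ J (φ t) = t := fun t ht => hinj.leftInvOn_invFunOn ht
  have hmap : ∀ t ∈ J, ∀ U ∈ 𝓝 t, φ '' U ∈ 𝓝 (φ t) := by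
    intro t ht U hU
    rw [← (hφ t ht).map_nhds_eq (hpos t ht)]
    exact Filter.image_mem_map hU
  have hopen : IsOpen (φ '' J) := by
    rw [isOpen_iff_mem_nhds]
    rintro _ ⟨t, ht, rfl⟩
    exact hmap t ht J (hJ.mem_nhds ht)
  refine ⟨hopen, fun t ht => ?_⟩
  have hcont : ContinuousAt (Function.invFunOn φ J) (φ t) := by
    intro U hU
    rw [hinv t ht] at hU
    rw [Filter.mem_map]
    -- Continuity of the inverse: `φ` maps neighbourhoods to neighbourhoods.
    filter_upwards [hmap t ht _ (Filter.inter_mem hU (hJ.mem_nhds ht))]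
    rintro _ ⟨τ, hτ, rfl⟩
    rw [Set.mem_preimage, hinv τ hτ.2]
    exact hτ.1
  refine HasDerivAt.of_local_left_inverse hcont (by rw [hinv t ht]; exact (hφ t ht).hasDerivAt)
    (hpos t ht) ?_
  filter_upwards [hopen.mem_nhds ⟨t, ht, rfl⟩]
  rintro _ ⟨τ, hτ, rfl⟩
  rw [hinv τ hτ]

end SurfaceMetric

/-! ### Parametrisation by arc length. -/

namespace SurfaceMetric

open LocalSurface

variable {M : Type*} [TopologicalSpace M] [ChartedSpace Plane M] [IsManifold (𝓡 2) ∞ M]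
  {g : SurfaceMetric M} {e : OpenPartialHomeomorph M Plane} {u : Plane}

theorem gradNorm_pos (hV : ∀ e ∈ IsManifold.maximalAtlas (𝓡 2) ∞ M, ∀ u ∈ e.target,
      g.gradComp e 0 u ≠ 0 ∨ g.gradComp e 1 u ≠ 0) (x : M) : 0 < g.gradNorm x := by
  have he : chartAt Plane x ∈ IsManifold.maximalAtlas (𝓡 2) ∞ M :=
    IsManifold.chart_mem_maximalAtlas x
  have hx := mem_chart_source Plane x
  have hu := (chartAt Plane x).map_source hx
  rw [g.gradNorm_eq he hx]
  exact Real.sqrt_pos.2 ((g.isMetricOn he).normSq_pos hu (hV _ he _ hu))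

theorem SolvesOn.contDiffOn_gradNorm {γ : ℝ → M} {J : Set ℝ} (hJ : IsOpen J)
    (hsol : SolvesOn g.gradComp γ J)
    (hV : ∀ e ∈ IsManifold.maximalAtlas (𝓡 2) ∞ M, ∀ u ∈ e.target,
      g.gradComp e 0 u ≠ 0 ∨ g.gradComp e 1 u ≠ 0) :
    ContDiffOn ℝ ∞ (fun t => g.gradNorm (γ t)) J := by
  intro t ht
  have he : chartAt Plane (γ t) ∈ IsManifold.maximalAtlas (𝓡 2) ∞ M :=
    IsManifold.chart_mem_maximalAtlas _
  have hx := mem_chart_source Plane (γ t)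
  set e := chartAt Plane (γ t)
  have hu := e.map_source hx
  have hO : J ∩ γ ⁻¹' e.source ∈ 𝓝 t :=
    (hsol.1.isOpen_inter_preimage hJ e.open_source).mem_nhds ⟨ht, hx⟩
  have h1 := (hsol.contDiffOn_chart hJ (fun e he u hu k => g.contDiffAt_gradComp he hu k)
    he).contDiffAt hO
  have h2 : ContDiffAt ℝ ∞ (fun v => √(normSq (g.inChart e) (g.gradComp e) v)) (e (γ t)) :=
    ((g.isMetricOn he).contDiffAt_normSq hu fun k => g.contDiffAt_gradComp he hu k).sqrt
      ((g.isMetricOn he).normSq_pos hu (hV _ he _ hu)).ne'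
  refine ((h2.comp t h1).congr_of_eventuallyEq ?_).contDiffWithinAt
  filter_upwards [hO] with τ hτ
  exact g.gradNorm_eq he hτ.2

/-- An integral curve of the gradient, parametrized by arc length, is an integral curve of the
normalized gradient; if the latter is autoparallel, the curve is a geodesic path. -/
theorem isGeodesicPathOn_of_solvesOn {γ : ℝ → M} {J : Set ℝ} (hJ : IsOpen J)
    (hJ' : J.OrdConnected) {t₀ : ℝ} (ht₀ : t₀ ∈ J) (hsol : SolvesOn g.gradComp γ J)
    (hV : ∀ e ∈ IsManifold.maximalAtlas (𝓡 2) ∞ M, ∀ u ∈ e.target,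
      g.gradComp e 0 u ≠ 0 ∨ g.gradComp e 1 u ≠ 0)
    (hpar : ∀ e ∈ IsManifold.maximalAtlas (𝓡 2) ∞ M, ∀ u ∈ e.target, ∀ k,
      selfDeriv (g.inChart e)
        (fun k v => g.gradComp e k v * (√(normSq (g.inChart e) (g.gradComp e) v))⁻¹) k u = 0) :
    g.IsGeodesicPathOn γ J := by
  set h : ℝ → ℝ := fun t => g.gradNorm (γ t) with hh
  have hsmooth : ContDiffOn ℝ ∞ h J := hsol.contDiffOn_gradNorm hJ hV
  have hpos : ∀ t, 0 < h t := fun t => gradNorm_pos hV _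
  -- Arc length measured from `t₀`: the velocity of `γ` is `grad c`, so its speed is `h`.
  set φ : ℝ → ℝ := fun t => ∫ τ in t₀..t, h τ with hφ
  have hder : ∀ t ∈ J, HasDerivAt φ (h t) t := by
    intro t ht
    refine intervalIntegral.integral_hasDerivAt_right ?_ ?_ ?_
    · exact (hsmooth.continuousOn.mono (hJ'.uIcc_subset ht₀ ht)).intervalIntegrable
    · exact hsmooth.continuousOn.stronglyMeasurableAtFilter hJ t ht
    · exact hsmooth.continuousOn.continuousAt (hJ.mem_nhds ht)
  have hφs : ContDiffOn ℝ ∞ φ J := by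
    rw [contDiffOn_infty_iff_deriv_of_isOpen hJ]
    exact ⟨fun t ht => (hder t ht).differentiableAt.differentiableWithinAt,
      hsmooth.congr fun t ht => (hder t ht).deriv⟩
  have hinj : Set.InjOn φ J := by
    refine StrictMonoOn.injOn (strictMonoOn_of_deriv_pos hJ'.convex hφs.continuousOn ?_)
    rw [hJ.interior_eq]
    intro t ht
    rw [(hder t ht).deriv]
    exact hpos t
  obtain ⟨hopen, hψ⟩ := hasDerivAt_invFunOn hJ hinj
    (fun t ht => by
      have := (hφs.contDiffAt (hJ.mem_nhds ht)).hasStrictDerivAt (by simp)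
      rwa [(hder t ht).deriv] at this) (fun t _ => (hpos t).ne')
  have hinv : ∀ t ∈ J, Function.invFunOn φ J (φ t) = t := fun t ht => hinj.leftInvOn_invFunOn ht
  refine ⟨φ, fun s => γ (Function.invFunOn φ J s), hφs,
    fun t ht => by rw [(hder t ht).deriv]; exact hpos t, ?_, fun t ht => by simp only [hinv t ht]⟩
  have hsol' : SolvesOn
      (fun e k v => g.gradComp e k v * (√(normSq (g.inChart e) (g.gradComp e) v))⁻¹)
      (fun s => γ (Function.invFunOn φ J s)) (φ '' J) := by
    constructor
    · refine hsol.1.comp (t := J) ?_ ?_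
      · rintro _ ⟨t, ht, rfl⟩
        exact (hψ t ht).continuousAt.continuousWithinAt
      · rintro _ ⟨t, ht, rfl⟩
        rw [hinv t ht]
        exact ht
    · rintro e he _ ⟨t, ht, rfl⟩ hs
      simp only [hinv t ht] at hs ⊢
      have h1 := hsol.2 e he t ht hs
      rw [← hinv t ht] at h1
      -- The derivative `1/h` of the inverse of `φ` is the factor that normalises the gradient.
      refine (h1.scomp (φ t) (hψ t ht)).congr_deriv ?_
      ext k
      simp only [hinv t ht, hh, g.gradNorm_eq he hs, PiLp.smul_apply, smul_eq_mul]
      ring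
  refine hsol'.isGeodesicOn hopen (fun e he u hu k => ?_) hpar
  exact (g.contDiffAt_gradComp he hu k).mul ((g.isMetricOn he).contDiffAt_inv_sqrt_normSq hu
    (fun k => g.contDiffAt_gradComp he hu k) (hV e he u hu))

end SurfaceMetric

end

theorem mainTheorem9 {M : Type*} [TopologicalSpace M] [ChartedSpace Plane M]
    [IsManifold (𝓡 2) ∞ M] (g : SurfaceMetric M)
    (hreg : g.IsRegular)
    (hcurv : ¬ ∃ k : ℝ, ∀ x : M, g.gaussianCurvature x = k)
    (hKilling : ∃ X : ∀ x : M, TangentSpace (𝓡 2) x, g.IsKilling X ∧ ∃ x, X x ≠ 0)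
    (J : Set ℝ) (hJ : IsOpen J) (hJ' : J.OrdConnected) (γ : ℝ → M)
    (hγ : IsMIntegralCurveOn γ (g.grad g.gaussianCurvature) J) :
    g.IsGeodesicPathOn γ J := by
  obtain ⟨X, hX, hX0⟩ := hKilling
  have hsol := SurfaceMetric.solvesOn_gradComp hJ hγ
  have hsm : ∀ e ∈ IsManifold.maximalAtlas (𝓡 2) ∞ M, ∀ u ∈ e.target, ∀ k,
      ContDiffAt ℝ ∞ (g.gradComp e k) u := fun e he u hu k => g.contDiffAt_gradComp he hu k
  rcases hreg.gradComp_eq_zero_or_ne_zero with hV | hV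
  -- The gradient vanishes identically. Since `M` need not be connected, this is compatible with a
  -- nonconstant `c`; the zero field is autoparallel, so no reparametrisation is needed.
  · refine ⟨id, γ, contDiffOn_id, fun t _ => by simp, ?_, fun t _ => rfl⟩
    rw [Set.image_id]
    refine hsol.isGeodesicOn hJ hsm fun e he u hu k => ?_
    simp [LocalSurface.selfDeriv, hV e he u hu]
  -- An empty `J` has no base point from which to measure arc length.
  · rcases J.eq_empty_or_nonempty with rfl | ⟨t₀, ht₀⟩
    · exact ⟨id, γ, contDiffOn_id, by simp, ⟨by simp [ContMDiffOn], by simp⟩, by simp⟩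
    exact SurfaceMetric.isGeodesicPathOn_of_solvesOn hJ hJ' ht₀ hsol hV
      fun e he u hu k => hreg.selfDeriv_normalized_grad hX hX0 hV he hu k
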